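/- **Theorem 2.2 (Convergence for quasi-equidistributing meshes).** Let $\Omega=(0,1)$, $V=H^1_0(\Omega)$, and let $a,b\in W^{1,\infty}(\Omega)$, $c\in L^\infty(\Omega)$ satisfy $a\ge a_0>0$ and $c-\tfrac12 b'\ge 0$ a.e. in $\Omega$ for some constant $a_0$. For $f\in L^2(\Omega)$ let $u\in V$ be the weak solution of $-(au')'+bu'+cu=f$, $u(0)=u(1)=0$, i.e. $$B(u,v)=\int_\Omega (au'v'+bu'v+cuv)\,dx=\int_\Omega fv\,dx\qquad\text{for all } v\in V,$$ and put $r=f+a'u'-bu'-cu$. For a mesh $0=x_0<x_1<\dots<x_N=1$ let $h_i=x_i-x_{i-1}$, let $V_h\subset V$ be the span of the linear basis (hat) functions of the interior mesh points, and let $u_h\in V_h$ be the linear finite element solution, $B(u_h,v_h)=\int_\Omega fv_h\,dx$ for all $v_h\in V_h$. Put $r_h=f+a'u_h'-bu_h'-cu_h$ and $$\langle r_h\rangle_i=\Big(\frac1{h_i}\int_{x_{i-1}}^{x_i}|r_h|^2dx\Big)^{1/2},\quad \alpha_h=\Big[\sum_{i=1}^N h_i\langle r_h\rangle_i^{2/3}\Big]^3,\quad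 \rho_i=\Big(1+\frac{1}{\alpha_h}\langle r_h\rangle_i^2\Big)^{1/3},\quad \sigma_h=\sum_{i=1}^N\rho_ih_i ,$$ with $\rho_i=1$ for all $i$ in the degenerate case $\alpha_h=0$. For $\kappa>0$, call the mesh quasi-equidistributing with constant $\kappa$ if $N\rho_ih_i/\sigma_h\le\kappa$ for $i=1,\dots,N$. Write $\|v\|_{L^{2/3}(\Omega)}=(\int_\Omega|v|^{2/3}dx)^{3/2}$. There are positive constants $C$ and $c_1$, depending only on $a,b,c$ (and $a_0$), but not on $f$, $u$, $\kappa$, $N$ or the mesh, such that for every $f\in L^2(\Omega)$ and every $\kappa>0$ the following hold. 1. For every mesh that is quasi-equidistributing with constant $\kappa$, $$\|(u-u_h)'\|_{L^2(\Omega)}\le\frac{C\sqrt{\alpha_h\kappa^3}}{N}.$$ 2. Along every sequence of meshes that are quasi-equidistributing with the same constant $\kappa$ and whose numbers of cells $N$ tend to infinity, $$\lim_{N\to\infty}\sqrt{\alpha_h}=\|r\|_{L^{2/3}(\Omega)}.$$ 3. If moreover $r'\in L^1(\Omega)$, then for every mesh that is quasi-equidistributing with constant $\kappa$ and satisfies $N>\kappa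 c_1$, $$\Big(1+\Big(\frac{\kappa c_1}{N}\Big)^{2/3}\Big)^{-3/2}\|r\|_{L^{2/3}(\Omega)}\le\sqrt{\alpha_h}\le\Big(1-\Big(\frac{\kappa c_1}{N}\Big)^{2/3}\Big)^{-3/2}\Big[\|r\|_{L^{2/3}(\Omega)}^{2/3}+\Big(\frac{\kappa c_1\|r'\|_{L^1(\Omega)}}{N}\Big)^{2/3}\Big]^{3/2}.$$ -/

import Mathlib

open MeasureTheory Filter Topology Set
open scoped ENNReal ContDiff

noncomputable section

namespace AdaptiveFEM

/-- The domain `Ω = (0, 1)`. -/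
def Omega : Set ℝ := Ioo 0 1

/-- Lebesgue measure on `Ω`. -/
abbrev muOmega : Measure ℝ := volume.restrict Omega

/-- The `L^p(Ω)` norm (a quasi-norm when `p < 1`). -/
def normLp (p : ℝ≥0∞) (v : ℝ → ℝ) : ℝ := (eLpNorm v p muOmega).toReal

/-- Smooth functions with compact support contained in `Ω`. -/
structure IsTestFunction (φ : ℝ → ℝ) : Prop where
  smooth : ContDiff ℝ ∞ φ
  compact : HasCompactSupport φ
  support : tsupport φ ⊆ Omega

/-- `w` is a weak derivative of `v` on `Ω`. -/
structure HasWeakDeriv (v w : ℝ → ℝ) : Prop where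
  locInt : LocallyIntegrableOn v Omega
  locInt_deriv : LocallyIntegrableOn w Omega
  integral_eq : ∀ φ : ℝ → ℝ, IsTestFunction φ →
    ∫ x in Omega, v x * deriv φ x = -∫ x in Omega, w x * φ x

open Classical in
/-- The weak derivative `v'` of `v` on `Ω` (unique up to a null set; by convention `0` if `v` has
no weak derivative). -/
def weakDeriv (v : ℝ → ℝ) : ℝ → ℝ :=
  if h : ∃ w, HasWeakDeriv v w then h.choose else 0

/-- The Sobolev space `W^{1,p}(Ω)`; `p = 2` gives `H¹(Ω)`. -/
def MemW1 (p : ℝ≥0∞) (v : ℝ → ℝ) : Prop :=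
  MemLp v p muOmega ∧ ∃ w, HasWeakDeriv v w ∧ MemLp w p muOmega

/-- The space `V = H¹₀(Ω)`: the closure of the test functions in `H¹(Ω)`. -/
def MemH10 (v : ℝ → ℝ) : Prop :=
  MemW1 2 v ∧ ∃ φ : ℕ → ℝ → ℝ, (∀ n, IsTestFunction (φ n)) ∧
    Tendsto (fun n => eLpNorm (φ n - v) 2 muOmega) atTop (𝓝 0) ∧
    Tendsto (fun n => eLpNorm (deriv (φ n) - weakDeriv v) 2 muOmega) atTop (𝓝 0)

/-- The assumptions on the coefficients `a, b, c` of `-(a u')' + b u' + c u = f`. -/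
structure Coefficients (a₀ : ℝ) (a b c : ℝ → ℝ) : Prop where
  pos : 0 < a₀
  a_mem : MemW1 ∞ a
  b_mem : MemW1 ∞ b
  c_mem : MemLp c ∞ muOmega
  elliptic : ∀ᵐ x ∂muOmega, a₀ ≤ a x
  coercive : ∀ᵐ x ∂muOmega, 0 ≤ c x - 1 / 2 * weakDeriv b x

/-- The bilinear form `B(u, v) = ∫_Ω (a u' v' + b u' v + c u v) dx`. -/
def bilin (a b c u v : ℝ → ℝ) : ℝ :=
  ∫ x in Omega, (a x * weakDeriv u x * weakDeriv v x + b x * weakDeriv u x * v x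
    + c x * u x * v x)

/-- The pairing `(f, v) = ∫_Ω f v dx`. -/
def pairing (f v : ℝ → ℝ) : ℝ := ∫ x in Omega, f x * v x

/-- `u` solves the variational problem: `u ∈ V` and `B(u, v) = (f, v)` for all `v ∈ V`. -/
def IsWeakSolution (a b c f u : ℝ → ℝ) : Prop :=
  MemH10 u ∧ ∀ v, MemH10 v → bilin a b c u v = pairing f v

/-- The residual `f + a' w' - b w' - c w` of a function `w`. For `w = u` this is `r`, for
`w = u_h` it is `r_h` (as `u_h'' = 0` in each cell). -/
def pdeResidual (a b c f w : ℝ → ℝ) : ℝ → ℝ := fun x =>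
  f x + weakDeriv a x * weakDeriv w x - b x * weakDeriv w x - c x * w x

/-- A mesh `0 = x₀ < x₁ < ⋯ < x_N = 1` with `N` cells. Only `x 0, …, x N` are meaningful. -/
structure Mesh (N : ℕ) where
  x : ℕ → ℝ
  x_zero : x 0 = 0
  x_last : x N = 1
  x_lt : ∀ i < N, x i < x (i + 1)

namespace Mesh

variable {N : ℕ} (π : Mesh N)

/-- The cells are numbered from `0`: for `i < N` the cell `i` is `(x i, x (i + 1))`. -/
def cell (i : ℕ) : Set ℝ := Ioo (π.x i) (π.x (i + 1))

/-- The length of the cell `i`. -/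
def len (i : ℕ) : ℝ := π.x (i + 1) - π.x i

/-- The linear basis function (hat function) of the interior mesh point `x i`, `0 < i < N`. -/
def hat (i : ℕ) : ℝ → ℝ := fun t =>
  max 0 (min ((t - π.x (i - 1)) / (π.x i - π.x (i - 1)))
    ((π.x (i + 1) - t) / (π.x (i + 1) - π.x i)))

/-- The linear finite element space `V_h`, the span of the hat functions at interior points. -/
def feSpace : Submodule ℝ (ℝ → ℝ) := Submodule.span ℝ (π.hat '' Ioo 0 N)

/-- `u_h` is the linear finite element solution on the mesh. -/
def IsFESolution (a b c f uh : ℝ → ℝ) : Prop :=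
  uh ∈ π.feSpace ∧ ∀ v ∈ π.feSpace, bilin a b c uh v = pairing f v

/-- The `L²` average of a function `v` over the cell `i`. -/
def avg (v : ℝ → ℝ) (i : ℕ) : ℝ :=
  Real.sqrt (1 / π.len i * ∫ x in π.cell i, |v x| ^ 2)

/-- The intensity parameter `α_h = (∑ h_i ⟨r_h⟩_i^{2/3})³` belonging to the residual `rh`. -/
def alpha (rh : ℝ → ℝ) : ℝ :=
  (∑ i ∈ Finset.range N, π.len i * π.avg rh i ^ (2 / 3 : ℝ)) ^ 3

/-- The value `ρ_i = (1 + ⟨r_h⟩_i² / α_h)^{1/3}` of the adaptation function in the cell `i`. If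
`α_h = 0`, then `⟨r_h⟩_i = 0` for all `i`, and `ρ_i = 1`. -/
def rho (rh : ℝ → ℝ) (i : ℕ) : ℝ :=
  (1 + 1 / π.alpha rh * π.avg rh i ^ 2) ^ (1 / 3 : ℝ)

/-- `σ_h = ∑ ρ_i h_i`. -/
def sigma (rh : ℝ → ℝ) : ℝ := ∑ i ∈ Finset.range N, π.rho rh i * π.len i

/-- The mesh is quasi-equidistributing with constant `κ` for the adaptation function built from
the residual `rh`: `N ρ_i h_i / σ_h ≤ κ` for all `i`. -/
def IsQuasiEquidistributing (rh : ℝ → ℝ) (κ : ℝ) : Prop :=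
  ∀ i < N, N * π.rho rh i * π.len i / π.sigma rh ≤ κ

end Mesh

end AdaptiveFEM

end

open AdaptiveFEM

/-! In one dimension the equation can be integrated once. Write $w=(u-u_h)'$ and $E=u-u_h$. The flux
$au'$ is a primitive of $bu'+cu-f$. On the discrete side, put $T=-au_h'-\int_0^x(f-bu_h'-cu_h)$.
Testing with the hat functions says exactly that all cell means of $T$ equal one constant $K$
(`exists_mean_eq`). Hence $R=T-K$ has mean zero on every cell, and there $R'=-r_h$, so
$|R|\le\int_{\text{cell}}|r_h|\le h_i\langle r_h\rangle_i$. Subtraction gives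
$aw=\text{const}+R+\int_0^x(bw+cE)$, and coercivity yields $a_0\|w\|_{L^2}\le\|R\|_{L^2}$
(`energy_estimate`).

Put $S(v)=\sum h_i\langle v\rangle_i^{2/3}$, so that $\alpha_h=S(r_h)^3$. Since $1\le\sigma_h\le2$,
quasi-equidistribution gives $\rho_ih_i\le2\kappa/N$, which contains both $h_i\le2\kappa/N$ and
$h_i\langle r_h\rangle_i^{2/3}\le(2\kappa/N)S(r_h)$. Therefore $\|R\|_{L^2}^2\le\sum h_i^3\langle
r_h\rangle_i^2=\sum(h_i\langle r_h\rangle_i^{2/3})^3\le(2\kappa/N)^2\alpha_h$. This is the error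
bound, even with $\kappa$ in place of $\kappa^{3/2}$; and $\kappa\ge1$ is automatic.

For the other two claims, $r-r_h=a'w-bw-cE$ is bounded by $|R|$, $\int|R|$ and a remainder small in
$L^2$ (`exists_stability`). As $S$ is subadditive, $S(r-r_h)\le(c_1\kappa/N)^{2/3}S(r_h)$
(`avgSum_sub_le`), so $S(r_h)$ and $S(r)$ agree up to factors $1\pm(c_1\kappa/N)^{2/3}$. The
residual $r$ no longer depends on the mesh: $S(r)\ge\int|r|^{2/3}$ by Jensen, and the excess is
controlled by the oscillation of $r$ on cells. It tends to zero by density of continuous functions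
(`exists_avgSum_le`) and has a rate when $r'\in L^1$ (`avgSum_le_of_memW1`). -/

namespace AdaptiveFEM

/-! ### Primitives of integrable functions on the unit interval. -/

/-- The primitive of `w` that vanishes at `0`. -/
noncomputable def prim (w : ℝ → ℝ) (x : ℝ) : ℝ := ∫ t in (0 : ℝ)..x, w t

theorem measurableSet_Omega : MeasurableSet Omega := measurableSet_Ioo

instance isProbabilityMeasure_muOmega : IsProbabilityMeasure muOmega :=
  ⟨by simp [Omega]⟩

theorem ae_mem_Omega : ∀ᵐ x ∂muOmega, x ∈ Omega := ae_restrict_mem measurableSet_Omega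

theorem ae_muOmega_of_forall {p : ℝ → Prop} (h : ∀ x ∈ Omega, p x) : ∀ᵐ x ∂muOmega, p x :=
  ae_mem_Omega.mono h

theorem Omega_subset_Icc : Omega ⊆ Icc 0 1 := Ioo_subset_Icc_self

theorem intervalIntegrable_iff_integrable_muOmega {w : ℝ → ℝ} :
    IntervalIntegrable w volume 0 1 ↔ Integrable w muOmega := by
  rw [intervalIntegrable_iff_integrableOn_Ioo_of_le zero_le_one]
  rfl

theorem integral_muOmega (w : ℝ → ℝ) : ∫ x in Omega, w x = prim w 1 := by
  rw [prim, intervalIntegral.integral_of_le zero_le_one, integral_Ioc_eq_integral_Ioo]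
  rfl

theorem Integrable.intervalIntegrable_of_mem {w : ℝ → ℝ} (hw : Integrable w muOmega) {s t : ℝ}
    (hs : s ∈ Icc (0 : ℝ) 1) (ht : t ∈ Icc (0 : ℝ) 1) : IntervalIntegrable w volume s t := by
  refine (intervalIntegrable_iff_integrable_muOmega.2 hw).mono_set ?_
  rw [uIcc_of_le (zero_le_one (α := ℝ))]
  exact uIcc_subset_Icc hs ht

theorem zero_mem_unitInterval : (0 : ℝ) ∈ Icc (0 : ℝ) 1 := ⟨le_rfl, zero_le_one⟩

theorem one_mem_unitInterval : (1 : ℝ) ∈ Icc (0 : ℝ) 1 := ⟨zero_le_one, le_rfl⟩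

@[simp] theorem prim_zero_right (w : ℝ → ℝ) : prim w 0 = 0 := by simp [prim]

theorem prim_sub_prim {w : ℝ → ℝ} (hw : Integrable w muOmega) {s t : ℝ}
    (hs : s ∈ Icc (0 : ℝ) 1) (ht : t ∈ Icc (0 : ℝ) 1) :
    prim w t - prim w s = ∫ x in s..t, w x :=
  intervalIntegral.integral_interval_sub_left
    (Integrable.intervalIntegrable_of_mem hw zero_mem_unitInterval ht)
    (Integrable.intervalIntegrable_of_mem hw zero_mem_unitInterval hs)

theorem intervalIntegral_congr_muOmega {v w : ℝ → ℝ} (h : v =ᵐ[muOmega] w) {s t : ℝ}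
    (hs : s ∈ Icc (0 : ℝ) 1) (ht : t ∈ Icc (0 : ℝ) 1) :
    ∫ x in s..t, v x = ∫ x in s..t, w x := by
  apply intervalIntegral.integral_congr_ae
  have h1 := (ae_restrict_iff' measurableSet_Omega).1 h
  -- Interval integrals run over half-open intervals, which never contain the left end `0` but may
  -- contain `1`; only `1` has to be discarded as a null set.
  have h2 : ∀ᵐ x : ℝ, x ≠ 1 := by simp [ae_iff, measure_singleton]
  filter_upwards [h1, h2] with x hx hx1 hxm
  apply hx
  have := uIoc_subset_uIcc hxm
  have h3 := uIcc_subset_Icc hs ht this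
  refine ⟨lt_of_le_of_ne h3.1 ?_, lt_of_le_of_ne h3.2 hx1⟩
  rintro rfl
  rcases mem_uIoc.1 hxm with h | h
  · exact absurd h.1 (not_lt.2 hs.1)
  · exact absurd h.1 (not_lt.2 ht.1)

theorem prim_congr {v w : ℝ → ℝ} (h : v =ᵐ[muOmega] w) {x : ℝ} (hx : x ∈ Icc (0 : ℝ) 1) :
    prim v x = prim w x :=
  intervalIntegral_congr_muOmega h zero_mem_unitInterval hx

theorem prim_add {v w : ℝ → ℝ} (hv : Integrable v muOmega) (hw : Integrable w muOmega) {x : ℝ}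
    (hx : x ∈ Icc (0 : ℝ) 1) : prim (fun t => v t + w t) x = prim v x + prim w x :=
  intervalIntegral.integral_add
    (Integrable.intervalIntegrable_of_mem hv zero_mem_unitInterval hx)
    (Integrable.intervalIntegrable_of_mem hw zero_mem_unitInterval hx)

theorem prim_sub {v w : ℝ → ℝ} (hv : Integrable v muOmega) (hw : Integrable w muOmega) {x : ℝ}
    (hx : x ∈ Icc (0 : ℝ) 1) : prim (fun t => v t - w t) x = prim v x - prim w x :=
  intervalIntegral.integral_sub
    (Integrable.intervalIntegrable_of_mem hv zero_mem_unitInterval hx)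
    (Integrable.intervalIntegrable_of_mem hw zero_mem_unitInterval hx)

theorem prim_const_mul (k : ℝ) (w : ℝ → ℝ) (x : ℝ) :
    prim (fun t => k * w t) x = k * prim w x :=
  intervalIntegral.integral_const_mul k w

theorem continuousOn_prim {w : ℝ → ℝ} (hw : Integrable w muOmega) :
    ContinuousOn (prim w) (Icc 0 1) := by
  have := intervalIntegral.continuousOn_primitive_interval'
    (intervalIntegrable_iff_integrable_muOmega.2 hw) (a := 0) (by simp)
  rwa [uIcc_of_le zero_le_one] at this

theorem abs_intervalIntegral_le {w : ℝ → ℝ} (hw : Integrable w muOmega) {s t : ℝ}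
    (hs : s ∈ Icc (0 : ℝ) 1) (ht : t ∈ Icc (0 : ℝ) 1) :
    |∫ x in s..t, w x| ≤ ∫ x in Omega, |w x| := by
  have h1 : |∫ x in s..t, w x| ≤ ∫ x in uIoc s t, |w x| :=
    intervalIntegral.norm_integral_le_integral_norm_uIoc (f := w) (μ := volume)
  refine h1.trans ?_
  have h2 : ∫ x in Omega, |w x| = ∫ x in Ioc (0 : ℝ) 1, |w x| :=
    integral_Ioc_eq_integral_Ioo.symm
  rw [h2]
  apply setIntegral_mono_set
  · exact ((intervalIntegrable_iff_integrableOn_Ioc_of_le zero_le_one).1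
      (intervalIntegrable_iff_integrable_muOmega.2 hw)).abs
  · exact Eventually.of_forall fun x => abs_nonneg _
  · exact (Ioc_subset_Ioc (le_min hs.1 ht.1) (max_le hs.2 ht.2)).eventuallyLE

theorem abs_prim_le {w : ℝ → ℝ} (hw : Integrable w muOmega) {x : ℝ}
    (hx : x ∈ Icc (0 : ℝ) 1) : |prim w x| ≤ ∫ x in Omega, |w x| :=
  abs_intervalIntegral_le hw zero_mem_unitInterval hx

theorem memLp_top_prim {w : ℝ → ℝ} (hw : Integrable w muOmega) : MemLp (prim w) ∞ muOmega := by
  refine memLp_top_of_bound ?_ (∫ x in Omega, |w x|)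
    (ae_muOmega_of_forall fun x hx => abs_prim_le hw (Omega_subset_Icc hx))
  exact ((continuousOn_prim hw).mono Omega_subset_Icc).aestronglyMeasurable measurableSet_Omega

theorem absolutelyContinuousOnInterval_prim {w : ℝ → ℝ} (hw : Integrable w muOmega) :
    AbsolutelyContinuousOnInterval (prim w) 0 1 :=
  (intervalIntegrable_iff_integrable_muOmega.2 hw)
    |>.absolutelyContinuousOnInterval_intervalIntegral (by simp)

theorem ae_hasDerivAt_prim {w : ℝ → ℝ} (hw : Integrable w muOmega) :
    ∀ᵐ x ∂muOmega, HasDerivAt (prim w) (w x) x := by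
  have h := (intervalIntegrable_iff_integrable_muOmega.2 hw).ae_hasDerivAt_integral
  rw [ae_restrict_iff' measurableSet_Omega]
  filter_upwards [h] with x hx hxO
  rw [uIcc_of_le zero_le_one] at hx
  exact hx (Omega_subset_Icc hxO) 0 zero_mem_unitInterval

theorem integrable_mul_of_memLp_top {v w : ℝ → ℝ} (hv : MemLp v ∞ muOmega)
    (hw : Integrable w muOmega) : Integrable (fun x => v x * w x) muOmega :=
  hv.integrable_mul (memLp_one_iff_integrable.2 hw)

/-- The product rule for primitives. -/
theorem prim_product {g h : ℝ → ℝ} (hg : Integrable g muOmega) (hh : Integrable h muOmega)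
    (k l : ℝ) {x : ℝ} (hx : x ∈ Icc (0 : ℝ) 1) :
    (k + prim g x) * (l + prim h x)
      = k * l + prim (fun t => (l + prim h t) * g t + (k + prim g t) * h t) x := by
  have hsub : uIcc 0 x ⊆ uIcc (0 : ℝ) 1 := by
    rw [uIcc_of_le (zero_le_one (α := ℝ))]; exact uIcc_subset_Icc zero_mem_unitInterval hx
  have key : ∀ (g : ℝ → ℝ) (k : ℝ), Integrable g muOmega →
      AbsolutelyContinuousOnInterval (fun x => k + prim g x) 0 x := by
    intro g k hg
    have h1 : AbsolutelyContinuousOnInterval (fun _ : ℝ => k) 0 x :=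
      (contDiff_const.contDiffOn (n := 1)).absolutelyContinuousOnInterval
    exact h1.add ((absolutelyContinuousOnInterval_prim hg).mono hsub)
  have hFG := ((key g k hg).mul (key h l hh)).integral_deriv_eq_sub
  simp only [Pi.mul_apply, prim_zero_right, add_zero] at hFG
  rw [← sub_eq_iff_eq_add', ← hFG, prim]
  apply intervalIntegral_congr_muOmega _ zero_mem_unitInterval hx
  filter_upwards [ae_hasDerivAt_prim hg, ae_hasDerivAt_prim hh] with t h1 h2
  have := ((h1.const_add k).mul (h2.const_add l)).deriv
  rw [this]; ring

theorem memLp_top_const_add_prim {g : ℝ → ℝ} (hg : Integrable g muOmega) (k : ℝ) :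
    MemLp (fun x => k + prim g x) ∞ muOmega :=
  (memLp_const k).add (memLp_top_prim hg)

/-- Integration by parts for primitives. -/
theorem integral_prim_mul {g h : ℝ → ℝ} (hg : Integrable g muOmega) (hh : Integrable h muOmega)
    (k l : ℝ) :
    ∫ x in Omega, (k + prim g x) * h x
      = (k + prim g 1) * (l + prim h 1) - k * l - ∫ x in Omega, (l + prim h x) * g x := by
  have h1 := prim_product hg hh k l one_mem_unitInterval
  rw [prim_add (integrable_mul_of_memLp_top (memLp_top_const_add_prim hh l) hg)
    (integrable_mul_of_memLp_top (memLp_top_const_add_prim hg k) hh) one_mem_unitInterval] at h1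
  rw [integral_muOmega, integral_muOmega, h1]
  ring

/-! ### Test functions, weak derivatives and boundary values in $H^1_0$. -/

namespace IsTestFunction

variable {φ ψ : ℝ → ℝ}

theorem eq_zero_of_notMem (h : IsTestFunction φ) {x : ℝ} (hx : x ∉ Omega) : φ x = 0 :=
  image_eq_zero_of_notMem_tsupport fun hx' => hx (h.support hx')

theorem differentiable (h : IsTestFunction φ) : Differentiable ℝ φ :=
  h.smooth.differentiable (by simp)

theorem deriv (h : IsTestFunction φ) : IsTestFunction (deriv φ) where
  smooth := (contDiff_infty_iff_deriv.1 h.smooth).2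
  compact := h.compact.deriv
  support := Subset.trans tsupport_deriv_subset h.support

theorem memLp_top (h : IsTestFunction φ) : MemLp φ ∞ muOmega :=
  (h.smooth.continuous.memLp_top_of_hasCompactSupport h.compact volume).restrict _

theorem integrable (h : IsTestFunction φ) : Integrable φ muOmega :=
  h.memLp_top.integrable le_top

theorem prim_deriv (h : IsTestFunction φ) (x : ℝ) : prim (_root_.deriv φ) x = φ x := by
  have h0 : φ 0 = 0 := h.eq_zero_of_notMem (by simp [Omega])
  rw [prim, intervalIntegral.integral_eq_sub_of_hasDerivAt
    (fun x _ => (h.differentiable x).hasDerivAt)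
    (h.deriv.smooth.continuous.intervalIntegrable _ _), h0, sub_zero]

theorem sub (hφ : IsTestFunction φ) (hψ : IsTestFunction ψ) :
    IsTestFunction (fun x => φ x - ψ x) where
  smooth := hφ.smooth.sub hψ.smooth
  compact := hφ.compact.sub hψ.compact
  support := (tsupport_sub φ ψ).trans (union_subset hφ.support hψ.support)

theorem const_mul (hφ : IsTestFunction φ) (k : ℝ) : IsTestFunction (fun x => k * φ x) where
  smooth := contDiff_const.mul hφ.smooth
  compact := hφ.compact.mul_left
  support := (closure_mono fun _ hx => right_ne_zero_of_mul hx).trans hφ.support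

/-- A test function with vanishing integral is the derivative of a test function. -/
theorem exists_deriv_eq (hψ : IsTestFunction ψ) (h0 : ∫ x in Omega, ψ x = 0) :
    ∃ φ, IsTestFunction φ ∧ _root_.deriv φ = ψ := by
  have hder : ∀ x, HasDerivAt (prim ψ) (ψ x) x := fun x =>
    intervalIntegral.integral_hasDerivAt_right (hψ.smooth.continuous.intervalIntegrable _ _)
      (hψ.smooth.continuous.stronglyMeasurableAtFilter _ _) hψ.smooth.continuous.continuousAt
  have hderiv : _root_.deriv (prim ψ) = ψ := funext fun x => (hder x).deriv
  -- The primitive vanishes left of `s` because the integrand does, and right of `t` because the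
  -- integral there is already the full one, which is zero.
  obtain ⟨s, t, hs, ht, hK⟩ : ∃ s t : ℝ, 0 < s ∧ t < 1 ∧ tsupport ψ ⊆ Icc s t := by
    rcases (tsupport ψ).eq_empty_or_nonempty with he | hne
    · exact ⟨1 / 2, 1 / 2, by norm_num, by norm_num, by simp [he]⟩
    · obtain ⟨s, hs⟩ := hψ.compact.isCompact.exists_isLeast hne
      obtain ⟨t, ht⟩ := hψ.compact.isCompact.exists_isGreatest hne
      exact ⟨s, t, (hψ.support hs.1).1, (hψ.support ht.1).2, fun x hx => ⟨hs.2 hx, ht.2 hx⟩⟩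
  have hz : ∀ x ∉ Icc s t, ψ x = 0 := fun x hx =>
    image_eq_zero_of_notMem_tsupport fun hx' => hx (hK hx')
  have hsupp : ∀ x ∉ Icc s t, prim ψ x = 0 := by
    intro x hx
    by_cases hxs : x < s
    · refine (intervalIntegral.integral_congr fun y hy => ?_).trans
        (intervalIntegral.integral_zero (a := 0) (b := x))
      refine hz y fun hy' => ?_
      exact absurd (lt_of_le_of_lt hy.2 (max_lt hs hxs)) (not_lt.2 hy'.1)
    · have hxt : t < x := by
        by_contra h
        exact hx ⟨not_lt.1 hxs, not_lt.1 h⟩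
      have hsub : ∀ b : ℝ, t < b → Function.support ψ ⊆ Ioc 0 b := fun b hb y hy =>
        have := hK (subset_tsupport _ hy)
        ⟨hs.trans_le this.1, this.2.trans hb.le⟩
      rw [integral_muOmega, prim,
        intervalIntegral.integral_eq_integral_of_support_subset (hsub 1 ht)] at h0
      rw [prim, intervalIntegral.integral_eq_integral_of_support_subset (hsub x hxt), h0]
  have hts : tsupport (prim ψ) ⊆ Icc s t :=
    closure_minimal (fun x hx => by_contra fun h => hx (hsupp x h)) isClosed_Icc
  refine ⟨prim ψ, ⟨?_, HasCompactSupport.intro isCompact_Icc hsupp, ?_⟩, hderiv⟩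
  · exact contDiff_infty_iff_deriv.2
      ⟨fun x => (hder x).differentiableAt, by rw [hderiv]; exact hψ.smooth⟩
  · exact hts.trans fun x hx => ⟨hs.trans_le hx.1, hx.2.trans_lt ht⟩

end IsTestFunction

/-- Serves to split a test function into a multiple of `η` and a part of mean zero in the du
Bois-Reymond lemma. -/
theorem exists_isTestFunction_integral_eq_one :
    ∃ η, IsTestFunction η ∧ ∫ x in Omega, η x = 1 := by
  let b : ContDiffBump (1 / 2 : ℝ) := ⟨1 / 8, 1 / 4, by norm_num, by norm_num⟩
  have hs : tsupport (b.normed volume) ⊆ Omega := by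
    rw [b.tsupport_normed_eq]
    intro x hx
    rw [Metric.mem_closedBall, Real.dist_eq, abs_le] at hx
    simp only [b] at hx
    constructor <;> linarith [hx.1, hx.2]
  refine ⟨b.normed volume, ⟨b.contDiff_normed, b.hasCompactSupport_normed, hs⟩, ?_⟩
  rw [setIntegral_eq_integral_of_forall_compl_eq_zero, b.integral_normed]
  exact fun x hx => image_eq_zero_of_notMem_tsupport fun h => hx (hs h)

theorem IsTestFunction.integrable_locallyIntegrableOn_mul {w φ : ℝ → ℝ} (hφ : IsTestFunction φ)
    (hw : LocallyIntegrableOn w Omega) : Integrable (fun x => w x * φ x) muOmega := by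
  have h1 : IntegrableOn w (tsupport φ) :=
    hw.integrableOn_compact_subset hφ.support hφ.compact.isCompact
  have h2 : IntegrableOn (fun x => w x * φ x) (tsupport φ) :=
    h1.mul_continuousOn hφ.smooth.continuous.continuousOn hφ.compact.isCompact
  refine ((integrableOn_iff_integrable_of_support_subset ?_).1 h2).restrict
  intro x hx
  exact subset_tsupport _ fun h => hx (by simp [h])

theorem ae_eq_zero_of_integral_test {d : ℝ → ℝ} (hd : LocallyIntegrableOn d Omega)
    (h : ∀ φ, IsTestFunction φ → ∫ x in Omega, d x * φ x = 0) : ∀ᵐ x ∂muOmega, d x = 0 := by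
  rw [ae_restrict_iff' measurableSet_Omega]
  refine isOpen_Ioo.ae_eq_zero_of_integral_contDiff_smul_eq_zero hd fun g hg hgc hgs => ?_
  have hφ : IsTestFunction g := ⟨hg, hgc, hgs⟩
  rw [← h g hφ, setIntegral_eq_integral_of_forall_compl_eq_zero]
  · simp [mul_comm]
  · intro x hx
    simp [hφ.eq_zero_of_notMem hx]

theorem Integrable.locallyIntegrableOn_Omega {w : ℝ → ℝ} (hw : Integrable w muOmega) :
    LocallyIntegrableOn w Omega :=
  IntegrableOn.locallyIntegrableOn hw

/-- Weak derivatives are unique up to null sets. -/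
theorem HasWeakDeriv.ae_unique {v v' w w' : ℝ → ℝ} (h : HasWeakDeriv v w)
    (h' : HasWeakDeriv v' w') (hv : v =ᵐ[muOmega] v') : w =ᵐ[muOmega] w' := by
  have := ae_eq_zero_of_integral_test (h.locInt_deriv.sub h'.locInt_deriv) fun φ hφ => by
    have e1 := h.integral_eq φ hφ
    have e2 := h'.integral_eq φ hφ
    have e3 : ∫ x in Omega, v x * _root_.deriv φ x = ∫ x in Omega, v' x * _root_.deriv φ x :=
      integral_congr_ae (hv.mono fun x hx => by simp only [hx])
    simp only [Pi.sub_apply, sub_mul]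
    rw [integral_sub (hφ.integrable_locallyIntegrableOn_mul h.locInt_deriv)
      (hφ.integrable_locallyIntegrableOn_mul h'.locInt_deriv)]
    linarith
  filter_upwards [this] with x hx
  simpa [sub_eq_zero] using hx

theorem HasWeakDeriv.hasWeakDeriv_weakDeriv {v w : ℝ → ℝ} (h : HasWeakDeriv v w) :
    HasWeakDeriv v (weakDeriv v) := by
  have hex : ∃ w, HasWeakDeriv v w := ⟨w, h⟩
  rw [weakDeriv, dif_pos hex]
  exact hex.choose_spec

theorem HasWeakDeriv.weakDeriv_ae_eq {v w : ℝ → ℝ} (h : HasWeakDeriv v w) :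
    weakDeriv v =ᵐ[muOmega] w :=
  h.hasWeakDeriv_weakDeriv.ae_unique h EventuallyEq.rfl

theorem MemW1.hasWeakDeriv {p : ℝ≥0∞} {v : ℝ → ℝ} (h : MemW1 p v) :
    HasWeakDeriv v (weakDeriv v) :=
  h.2.choose_spec.1.hasWeakDeriv_weakDeriv

theorem MemW1.memLp_weakDeriv {p : ℝ≥0∞} {v : ℝ → ℝ} (h : MemW1 p v) :
    MemLp (weakDeriv v) p muOmega :=
  (memLp_congr_ae h.2.choose_spec.1.weakDeriv_ae_eq).2 h.2.choose_spec.2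

theorem hasWeakDeriv_of_ae_eq_prim {v w : ℝ → ℝ} {k : ℝ} (hw : Integrable w muOmega)
    (hv : ∀ᵐ x ∂muOmega, v x = k + prim w x) : HasWeakDeriv v w where
  locInt := by
    have h : Integrable v muOmega :=
      ((memLp_top_const_add_prim hw k).integrable le_top).congr (hv.mono fun x hx => hx.symm)
    exact Integrable.locallyIntegrableOn_Omega h
  locInt_deriv := Integrable.locallyIntegrableOn_Omega hw
  integral_eq φ hφ := by
    have h1 := integral_prim_mul hw hφ.deriv.integrable k 0
    simp only [hφ.prim_deriv, hφ.eq_zero_of_notMem (x := 1) (by simp [Omega])] at h1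
    rw [integral_congr_ae (hv.mono fun x hx => show _ = (k + prim w x) * _root_.deriv φ x by
      rw [hx]), h1]
    simp [mul_comm]

/-- The du Bois-Reymond lemma: a function with an integrable weak derivative is a primitive. -/
theorem HasWeakDeriv.exists_ae_eq_prim {v w : ℝ → ℝ} (h : HasWeakDeriv v w)
    (hw : Integrable w muOmega) : ∃ k, ∀ᵐ x ∂muOmega, v x = k + prim w x := by
  obtain ⟨η, hη, hη1⟩ := exists_isTestFunction_integral_eq_one
  set z : ℝ → ℝ := fun x => v x - prim w x with hz
  have hpl : LocallyIntegrableOn (prim w) Omega :=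
    Integrable.locallyIntegrableOn_Omega ((memLp_top_prim hw).integrable le_top)
  have hzl : LocallyIntegrableOn z Omega := h.locInt.sub hpl
  have hz0 : ∀ φ, IsTestFunction φ → ∫ x in Omega, z x * _root_.deriv φ x = 0 := by
    intro φ hφ
    have h1 := (hasWeakDeriv_of_ae_eq_prim (v := prim w) (k := 0) hw (by simp)).integral_eq φ hφ
    simp only [hz, sub_mul]
    rw [integral_sub (hφ.deriv.integrable_locallyIntegrableOn_mul h.locInt)
      (hφ.deriv.integrable_locallyIntegrableOn_mul hpl), h.integral_eq φ hφ, h1, sub_self]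
  -- The constant is found by testing `z` with `η`: every `ψ` is its mean times `η` plus the
  -- derivative of a test function, and `z` annihilates such derivatives, so $\int z\psi=k\int\psi$.
  set k := ∫ x in Omega, z x * η x
  have hk : LocallyIntegrableOn (fun _ : ℝ => k) Omega :=
    Integrable.locallyIntegrableOn_Omega (integrable_const k)
  have := ae_eq_zero_of_integral_test (hzl.sub hk) fun ψ hψ => by
    set m := ∫ x in Omega, ψ x with hm
    have hmean : ∫ x in Omega, (ψ x - m * η x) = 0 := by
      rw [integral_sub hψ.integrable (hη.integrable.const_mul m), integral_const_mul, hη1,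
        mul_one, sub_self]
    obtain ⟨φ, hφ, hφd⟩ := (hψ.sub (hη.const_mul m)).exists_deriv_eq hmean
    have e := hz0 φ hφ
    rw [hφd] at e
    simp only [mul_sub] at e
    have hi2 : Integrable (fun x => z x * (m * η x)) muOmega :=
      (hη.const_mul m).integrable_locallyIntegrableOn_mul hzl
    rw [integral_sub (hψ.integrable_locallyIntegrableOn_mul hzl) hi2] at e
    have e2 : ∫ x in Omega, z x * (m * η x) = m * k := by
      rw [← integral_const_mul]; congr 1; ext x; ring
    simp only [Pi.sub_apply, sub_mul]
    rw [integral_sub (hψ.integrable_locallyIntegrableOn_mul hzl)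
      (hψ.integrable_locallyIntegrableOn_mul hk), integral_const_mul, ← hm]
    linarith
  refine ⟨k, this.mono fun x hx => ?_⟩
  simp only [Pi.sub_apply, hz] at hx
  linarith

theorem IsTestFunction.hasWeakDeriv {φ : ℝ → ℝ} (hφ : IsTestFunction φ) :
    HasWeakDeriv φ (_root_.deriv φ) :=
  hasWeakDeriv_of_ae_eq_prim (k := 0) hφ.deriv.integrable (by simp [hφ.prim_deriv])

theorem IsTestFunction.memH10 {φ : ℝ → ℝ} (hφ : IsTestFunction φ) : MemH10 φ := by
  refine ⟨⟨hφ.memLp_top.mono_exponent le_top, _, hφ.hasWeakDeriv,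
    hφ.deriv.memLp_top.mono_exponent le_top⟩, fun _ => φ, fun _ => hφ, by simp, ?_⟩
  have : eLpNorm (_root_.deriv φ - weakDeriv φ) 2 muOmega = 0 := by
    rw [eLpNorm_congr_ae (g := 0)]
    · simp
    · filter_upwards [hφ.hasWeakDeriv.weakDeriv_ae_eq] with x hx
      simp [hx]
  simp [this]

theorem MemLp.integral_abs_le_toReal_eLpNorm_two {g : ℝ → ℝ} (hg : MemLp g 2 muOmega) :
    ∫ x in Omega, |g x| ≤ (eLpNorm g 2 muOmega).toReal := by
  have h1 : ∫ x in Omega, |g x| = (eLpNorm g 1 muOmega).toReal := by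
    rw [eLpNorm_one_eq_lintegral_enorm]
    exact integral_norm_eq_lintegral_enorm hg.1
  rw [h1]
  exact ENNReal.toReal_mono hg.eLpNorm_ne_top
    (eLpNorm_le_eLpNorm_of_exponent_le (by norm_num) hg.1)

/-- Functions in `H¹₀(Ω)` are primitives of square integrable functions with mean zero. -/
theorem MemH10.ae_eq_prim {v : ℝ → ℝ} (h : MemH10 v) :
    (∀ᵐ x ∂muOmega, v x = prim (weakDeriv v) x) ∧ prim (weakDeriv v) 1 = 0 := by
  obtain ⟨hW, φ, hφ, hφv, hφw⟩ := h
  set w := weakDeriv v with hwdef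
  have hw2 : MemLp w 2 muOmega := hW.memLp_weakDeriv
  have hw : Integrable w muOmega := hw2.integrable (by norm_num)
  obtain ⟨k, hk⟩ := hW.hasWeakDeriv.exists_ae_eq_prim hw
  have hd2 : ∀ n, MemLp (_root_.deriv (φ n) - w) 2 muOmega := fun n =>
    ((hφ n).deriv.memLp_top.mono_exponent le_top).sub hw2
  have hv2 : ∀ n, MemLp (φ n - v) 2 muOmega := fun n =>
    ((hφ n).memLp_top.mono_exponent le_top).sub hW.1
  -- Convergence of derivatives in $L^2$ forces uniform convergence of primitives, so the zero
  -- boundary values of the `φ n` survive in the limit.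
  have key : ∀ n, ∀ x ∈ Icc (0 : ℝ) 1,
      |φ n x - prim w x| ≤ (eLpNorm (_root_.deriv (φ n) - w) 2 muOmega).toReal := by
    intro n x hx
    rw [← (hφ n).prim_deriv x, ← prim_sub (hφ n).deriv.integrable hw hx]
    exact (abs_prim_le ((hφ n).deriv.integrable.sub hw) hx).trans
      (MemLp.integral_abs_le_toReal_eLpNorm_two (hd2 n))
  have t1 := (ENNReal.tendsto_toReal ENNReal.zero_ne_top).comp hφw
  have t2 := (ENNReal.tendsto_toReal ENNReal.zero_ne_top).comp hφv
  have h1 : prim w 1 = 0 := by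
    have : |prim w 1| ≤ 0 := by
      refine ge_of_tendsto t1 (Eventually.of_forall fun n => ?_)
      have := key n 1 one_mem_unitInterval
      rw [(hφ n).eq_zero_of_notMem (x := 1) (by simp [Omega]), zero_sub, abs_neg] at this
      exact this
    exact abs_nonpos_iff.1 this
  -- Here $k=v-\mathrm{prim}\,w$ is compared with `φ n`: the constant equals its own mean, which is
  -- at most the uniform distance of `φ n` to `prim w` plus the $L^2$ distance to `v`.
  have hk0 : k = 0 := by
    have : |k| ≤ 0 := by
      have t3 := t1.add t2
      simp only [ENNReal.toReal_zero, add_zero] at t3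
      refine ge_of_tendsto t3 (Eventually.of_forall fun n => ?_)
      have e1 : ∫ _ in Omega, |k| = |k| := by simp [Omega]
      rw [← e1]
      refine (integral_mono_ae (g := fun x =>
        (eLpNorm (_root_.deriv (φ n) - w) 2 muOmega).toReal + |(φ n - v) x|)
        (integrable_const _) ((integrable_const _).add
          ((hv2 n).integrable (by norm_num)).abs) ?_).trans ?_
      · filter_upwards [hk, ae_mem_Omega] with x hx hxO
        have e2 := key n x (Omega_subset_Icc hxO)
        have : k = (φ n x - prim w x) - (φ n - v) x := by
          simp [hx, hwdef]
        calc |k| ≤ |φ n x - prim w x| + |(φ n - v) x| := by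
              conv_lhs => rw [this]
              exact abs_sub _ _
          _ ≤ _ := by gcongr
      · rw [integral_add (integrable_const _) ((hv2 n).integrable (by norm_num)).abs]
        have := MemLp.integral_abs_le_toReal_eLpNorm_two (hv2 n)
        rw [integral_const, probReal_univ, one_smul]
        exact add_le_add le_rfl this
    exact abs_nonpos_iff.1 this
  exact ⟨hk.mono fun x hx => by rw [hx, hk0, zero_add], h1⟩

theorem MemH10.memLp_weakDeriv {v : ℝ → ℝ} (h : MemH10 v) : MemLp (weakDeriv v) 2 muOmega :=
  h.1.memLp_weakDeriv

/-! ### Meshes and finite element functions as primitives of step functions. -/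

/-- Away from the kinks, the tent function on `p < q < r` is differentiable. -/
theorem hasDerivAt_tent {p q r t : ℝ} (hpq : p < q) (hqr : q < r) (hp : t ≠ p) (hq : t ≠ q)
    (hr : t ≠ r) :
    HasDerivAt (fun t => max 0 (min ((t - p) / (q - p)) ((r - t) / (r - q))))
      ((Ioo p q).indicator (fun _ => 1 / (q - p)) t
        - (Ioo q r).indicator (fun _ => 1 / (r - q)) t) t := by
  have hqp' : 0 < q - p := sub_pos.2 hpq
  have hrq' : 0 < r - q := sub_pos.2 hqr
  rcases lt_or_gt_of_ne hp with h1 | h1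
  · have e1 : t ∉ Ioo p q := fun h => absurd h.1 (not_lt.2 h1.le)
    have e2 : t ∉ Ioo q r := fun h => absurd h.1 (not_lt.2 (h1.trans hpq).le)
    rw [indicator_of_notMem e1, indicator_of_notMem e2, sub_zero]
    refine (hasDerivAt_const t (0 : ℝ)).congr_of_eventuallyEq ?_
    filter_upwards [Iio_mem_nhds h1] with y hy
    refine max_eq_left ((min_le_left _ _).trans ?_)
    exact div_nonpos_of_nonpos_of_nonneg (sub_nonpos.2 (le_of_lt hy)) hqp'.le
  rcases lt_or_gt_of_ne hq with h2 | h2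
  · have e1 : t ∈ Ioo p q := ⟨h1, h2⟩
    have e2 : t ∉ Ioo q r := fun h => absurd h.1 (not_lt.2 h2.le)
    rw [indicator_of_mem e1, indicator_of_notMem e2, sub_zero]
    refine (((hasDerivAt_id t).sub_const p).div_const (q - p)).congr_of_eventuallyEq ?_
    filter_upwards [Ioo_mem_nhds h1 h2] with y hy
    have h3 : (y - p) / (q - p) ≤ 1 := (div_le_one hqp').2 (by linarith [hy.2])
    have h4 : 1 ≤ (r - y) / (r - q) := (one_le_div hrq').2 (by linarith [hy.2])
    rw [min_eq_left (h3.trans h4)]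
    exact max_eq_right (div_nonneg (by linarith [hy.1]) hqp'.le)
  rcases lt_or_gt_of_ne hr with h3 | h3
  · have e1 : t ∉ Ioo p q := fun h => absurd h.2 (not_lt.2 h2.le)
    have e2 : t ∈ Ioo q r := ⟨h2, h3⟩
    rw [indicator_of_notMem e1, indicator_of_mem e2, zero_sub, ← neg_div]
    refine (((hasDerivAt_id t).const_sub r).div_const (r - q)).congr_of_eventuallyEq ?_
    filter_upwards [Ioo_mem_nhds h2 h3] with y hy
    have h3 : (r - y) / (r - q) ≤ 1 := (div_le_one hrq').2 (by linarith [hy.1])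
    have h4 : 1 ≤ (y - p) / (q - p) := (one_le_div hqp').2 (by linarith [hy.1])
    rw [min_eq_right (h3.trans h4)]
    exact max_eq_right (div_nonneg (by linarith [hy.2]) hrq'.le)
  · have e1 : t ∉ Ioo p q := fun h => absurd h.2 (not_lt.2 h2.le)
    have e2 : t ∉ Ioo q r := fun h => absurd h.2 (not_lt.2 h3.le)
    rw [indicator_of_notMem e1, indicator_of_notMem e2, sub_zero]
    refine (hasDerivAt_const t (0 : ℝ)).congr_of_eventuallyEq ?_
    filter_upwards [Ioi_mem_nhds h3] with y hy
    refine max_eq_left ((min_le_right _ _).trans ?_)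
    exact div_nonpos_of_nonpos_of_nonneg (sub_nonpos.2 (le_of_lt hy)) hrq'.le

namespace Mesh

variable {N : ℕ} (π : Mesh N)

theorem x_mono {i j : ℕ} (hij : i ≤ j) (hj : j ≤ N) : π.x i ≤ π.x j := by
  induction j, hij using Nat.le_induction with
  | base => rfl
  | succ k _ ih => exact (ih (by omega)).trans (π.x_lt k (by omega)).le

theorem x_mem {i : ℕ} (hi : i ≤ N) : π.x i ∈ Icc (0 : ℝ) 1 :=
  ⟨π.x_zero ▸ π.x_mono (Nat.zero_le i) hi, π.x_last ▸ π.x_mono hi le_rfl⟩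

theorem len_pos {i : ℕ} (hi : i < N) : 0 < π.len i := sub_pos.2 (π.x_lt i hi)

theorem pos (π : Mesh N) : 0 < N := by
  rcases Nat.eq_zero_or_pos N with h | h
  · have h2 : π.x 0 = 1 := (congrArg π.x h.symm).trans π.x_last
    rw [π.x_zero] at h2
    exact absurd h2 zero_ne_one
  · exact h

theorem sum_len : ∑ i ∈ Finset.range N, π.len i = 1 := by
  simp only [len]
  rw [Finset.sum_range_sub, π.x_zero, π.x_last, sub_zero]

theorem measurableSet_cell (i : ℕ) : MeasurableSet (π.cell i) := measurableSet_Ioo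

theorem cell_subset {i : ℕ} (hi : i < N) : π.cell i ⊆ Omega := fun _ hx =>
  ⟨(π.x_mem hi.le).1.trans_lt hx.1, hx.2.trans_le (π.x_mem (Nat.succ_le_of_lt hi)).2⟩

theorem disjoint_cell {i j : ℕ} (hij : i ≠ j) (hi : i < N) (hj : j < N) :
    Disjoint (π.cell i) (π.cell j) := by
  rw [Set.disjoint_left]
  rintro x ⟨h1, h2⟩ ⟨h3, h4⟩
  rcases lt_or_gt_of_ne hij with h | h
  · exact absurd (h2.trans_le (π.x_mono h hj.le)) (not_lt.2 h3.le)
  · exact absurd (h4.trans_le (π.x_mono h hi.le)) (not_lt.2 h1.le)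

/-- The slope of the hat function of `x i`. -/
noncomputable def hatSlope (i : ℕ) : ℝ → ℝ := fun t =>
  (π.cell (i - 1)).indicator (fun _ => 1 / π.len (i - 1)) t
    - (π.cell i).indicator (fun _ => 1 / π.len i) t

theorem memLp_hatSlope (i : ℕ) : MemLp (π.hatSlope i) ∞ muOmega := by
  have h : ∀ (j : ℕ) (k : ℝ), MemLp ((π.cell j).indicator fun _ => k) ∞ muOmega := fun j k =>
    (memLp_const k).indicator (π.measurableSet_cell j)
  exact (h _ _).sub (h _ _)

theorem hat_eq_prim {i : ℕ} (hi : i ∈ Ioo 0 N) :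
    (∀ t ∈ Icc (0 : ℝ) 1, π.hat i t = prim (π.hatSlope i) t) ∧ π.hat i 1 = 0 := by
  obtain ⟨h0, hN⟩ := hi
  -- The hat function of `x i` lives on the cells `i - 1` and `i`; interior points have `0 < i`, so
  -- the subtraction is not truncated.
  have hi1 : i - 1 + 1 = i := by omega
  have hpq : π.x (i - 1) < π.x i := by
    have := π.x_lt (i - 1) (by omega)
    rwa [hi1] at this
  have hqr : π.x i < π.x (i + 1) := π.x_lt i hN
  have hat0 : π.hat i 0 = 0 := by
    refine max_eq_left ((min_le_left _ _).trans ?_)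
    exact div_nonpos_of_nonpos_of_nonneg
      (by linarith [(π.x_mem (i := i - 1) (by omega)).1]) (sub_pos.2 hpq).le
  refine ⟨fun t ht => ?_, ?_⟩
  · have hint := Integrable.intervalIntegrable_of_mem ((π.memLp_hatSlope i).integrable le_top)
      zero_mem_unitInterval ht
    have hcont : Continuous (π.hat i) := by
      unfold hat
      fun_prop
    rw [prim, integral_eq_of_hasDerivAt_off_countable (π.hat i) (π.hatSlope i)
      (s := {π.x (i - 1), π.x i, π.x (i + 1)}) (Set.toFinite _).countable hcont.continuousOn
      ?_ hint, hat0, sub_zero]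
    rintro y ⟨-, hy⟩
    simp only [mem_insert_iff, mem_singleton_iff, not_or] at hy
    have := hasDerivAt_tent hpq hqr hy.1 hy.2.1 hy.2.2
    have hfun : π.hat i = fun t => max 0 (min ((t - π.x (i - 1)) / (π.x i - π.x (i - 1)))
      ((π.x (i + 1) - t) / (π.x (i + 1) - π.x i))) := rfl
    rw [hfun]
    simpa only [hatSlope, cell, len, hi1] using this
  · refine max_eq_left ((min_le_right _ _).trans ?_)
    exact div_nonpos_of_nonpos_of_nonneg
      (by linarith [(π.x_mem (i := i + 1) (by omega)).2]) (sub_pos.2 hqr).le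

/-- Finite element functions are primitives of functions that are constant on each cell. -/
theorem exists_slope {v : ℝ → ℝ} (hv : v ∈ π.feSpace) :
    ∃ (s : ℝ → ℝ) (σ : ℕ → ℝ), MemLp s ∞ muOmega ∧ (∀ i < N, ∀ x ∈ π.cell i, s x = σ i) ∧
      (∀ x ∈ Icc (0 : ℝ) 1, v x = prim s x) ∧ prim s 1 = 0 := by
  induction hv using Submodule.span_induction with
  | mem v hv =>
    obtain ⟨i, hi, rfl⟩ := hv
    obtain ⟨h1, h2⟩ := π.hat_eq_prim hi
    refine ⟨π.hatSlope i, fun j => (if j = i - 1 then 1 / π.len (i - 1) else 0)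
      - (if j = i then 1 / π.len i else 0), π.memLp_hatSlope i, fun j hj x hx => ?_, h1, ?_⟩
    · have key : ∀ k < N, ∀ l : ℝ, (π.cell k).indicator (fun _ => l) x = if j = k then l else 0 := by
        intro k hk l
        split_ifs with h
        · subst h
          exact indicator_of_mem hx _
        · exact indicator_of_notMem (fun h' => (Set.disjoint_left.1 (π.disjoint_cell h hj hk)) hx h') _
      rw [hatSlope, key _ (by have := hi.2; omega), key _ hi.2]
    · rw [← h1 1 one_mem_unitInterval, h2]
  | zero => exact ⟨0, 0, MemLp.zero, by simp, by simp [prim], by simp [prim]⟩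
  | add v w _ _ hv hw =>
    obtain ⟨s, σ, hs, h1, h2, h3⟩ := hv
    obtain ⟨t, τ, ht, k1, k2, k3⟩ := hw
    have hp : ∀ x ∈ Icc (0 : ℝ) 1, prim (fun y => s y + t y) x = prim s x + prim t x :=
      fun x hx => prim_add (hs.integrable le_top) (ht.integrable le_top) hx
    refine ⟨fun y => s y + t y, fun i => σ i + τ i, hs.add ht,
      fun i hi x hx => by simp only [h1 i hi x hx, k1 i hi x hx],
      fun x hx => by rw [hp x hx, Pi.add_apply, h2 x hx, k2 x hx], ?_⟩
    rw [hp 1 one_mem_unitInterval, h3, k3, add_zero]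
  | smul k v _ hv =>
    obtain ⟨s, σ, hs, h1, h2, h3⟩ := hv
    refine ⟨fun y => k * s y, fun i => k * σ i, hs.const_mul k,
      fun i hi x hx => by simp only [h1 i hi x hx],
      fun x hx => by rw [prim_const_mul, Pi.smul_apply, h2 x hx, smul_eq_mul], ?_⟩
    rw [prim_const_mul, h3, mul_zero]

/-- Cellwise summation of integrals. -/
theorem sum_integral_cell {g : ℝ → ℝ} (hg : Integrable g muOmega) :
    ∑ i ∈ Finset.range N, ∫ x in π.cell i, g x = ∫ x in Omega, g x := by
  have h : ∀ n ≤ N, ∑ i ∈ Finset.range n, ∫ x in π.cell i, g x = prim g (π.x n) := by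
    intro n hn
    induction n with
    | zero => simp [π.x_zero]
    | succ k ih =>
      rw [Finset.sum_range_succ, ih (by omega), eq_comm, ← sub_eq_iff_eq_add',
        prim_sub_prim hg (π.x_mem (by omega)) (π.x_mem hn),
        intervalIntegral.integral_of_le (π.x_lt k (by omega)).le, integral_Ioc_eq_integral_Ioo]
      rfl
  rw [h N le_rfl, π.x_last, integral_muOmega]

end Mesh

/-! ### Coercivity, energy and stability estimates for the integrated equation. -/

theorem MemLp.exists_ae_abs_le {g : ℝ → ℝ} (hg : MemLp g ∞ muOmega) :
    ∃ M : ℝ, ∀ᵐ x ∂muOmega, |g x| ≤ M := by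
  refine ⟨(eLpNormEssSup g muOmega).toReal, ?_⟩
  have hfin : eLpNormEssSup g muOmega ≠ ⊤ := by
    have := hg.eLpNorm_ne_top
    rwa [eLpNorm_exponent_top] at this
  filter_upwards [ae_le_eLpNormEssSup (f := g) (μ := muOmega)] with x hx
  have := ENNReal.toReal_mono hfin hx
  simpa using this

theorem integrable_mul_of_memLp_two {g h : ℝ → ℝ} (hg : MemLp g 2 muOmega)
    (hh : MemLp h 2 muOmega) : Integrable (fun x => g x * h x) muOmega :=
  hg.integrable_mul hh

theorem memLp_two_of_top_mul {g h : ℝ → ℝ} (hg : MemLp g ∞ muOmega)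
    (hh : MemLp h 2 muOmega) : MemLp (fun x => g x * h x) 2 muOmega :=
  hh.mul' hg

theorem MemLp.memLp_two_of_top {g : ℝ → ℝ} (hg : MemLp g ∞ muOmega) : MemLp g 2 muOmega :=
  hg.mono_exponent le_top

theorem MemLp.integrable_of_two {g : ℝ → ℝ} (hg : MemLp g 2 muOmega) : Integrable g muOmega :=
  hg.integrable (by norm_num)

theorem sq_integral_abs_le {g : ℝ → ℝ} (hg : MemLp g 2 muOmega) :
    (∫ x in Omega, |g x|) ^ 2 ≤ ∫ x in Omega, g x ^ 2 := by
  have hi : Integrable (fun x => |g x|) muOmega := (MemLp.integrable_of_two hg).abs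
  set m := ∫ x in Omega, |g x| with hm
  -- The variance of `|g|` is nonnegative, and `Ω` has measure one.
  have h0 : 0 ≤ ∫ x in Omega, (|g x| - m) ^ 2 := integral_nonneg fun x => sq_nonneg _
  have h1 : ∀ x, (|g x| - m) ^ 2 = g x ^ 2 - 2 * m * |g x| + m ^ 2 := fun x => by
    rw [sub_sq, sq_abs]; ring
  simp only [h1] at h0
  have i1 : Integrable (fun x => g x ^ 2 - 2 * m * |g x|) muOmega :=
    hg.integrable_sq.sub (hi.const_mul _)
  rw [integral_add i1 (integrable_const _),
    integral_sub hg.integrable_sq (hi.const_mul _), integral_const_mul, integral_const,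
    probReal_univ, one_smul, ← hm] at h0
  linarith

namespace Coefficients

variable {a₀ : ℝ} {a b c : ℝ → ℝ}

theorem exists_bound (hc : Coefficients a₀ a b c) : ∃ M : ℝ, 1 ≤ M ∧ ∀ᵐ x ∂muOmega,
    |a x| ≤ M ∧ |b x| ≤ M ∧ |c x| ≤ M ∧ |weakDeriv a x| ≤ M := by
  obtain ⟨M₁, h1⟩ := MemLp.exists_ae_abs_le hc.a_mem.1
  obtain ⟨M₂, h2⟩ := MemLp.exists_ae_abs_le hc.b_mem.1
  obtain ⟨M₃, h3⟩ := MemLp.exists_ae_abs_le hc.c_mem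
  obtain ⟨M₄, h4⟩ := MemLp.exists_ae_abs_le hc.a_mem.memLp_weakDeriv
  refine ⟨max 1 (max (max M₁ M₂) (max M₃ M₄)), le_max_left _ _, ?_⟩
  filter_upwards [h1, h2, h3, h4] with x k1 k2 k3 k4
  refine ⟨k1.trans ?_, k2.trans ?_, k3.trans ?_, k4.trans ?_⟩ <;> simp

theorem memLp_inv (hc : Coefficients a₀ a b c) : MemLp (fun x => (a x)⁻¹) ∞ muOmega := by
  refine memLp_top_of_bound hc.a_mem.1.1.aemeasurable.inv.aestronglyMeasurable a₀⁻¹ ?_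
  filter_upwards [hc.elliptic] with x hx
  have := hc.pos
  rw [Real.norm_eq_abs, abs_inv, abs_of_pos (this.trans_le hx)]
  gcongr

/-- Coercivity of the bilinear form on `H¹₀(Ω)`. -/
theorem coercivity (hc : Coefficients a₀ a b c) {w : ℝ → ℝ} (hw : MemLp w 2 muOmega)
    (h1 : prim w 1 = 0) :
    a₀ * ∫ x in Omega, w x ^ 2 ≤
      ∫ x in Omega, (a x * w x ^ 2 + prim w x * (b x * w x + c x * prim w x)) := by
  have hwi := MemLp.integrable_of_two hw
  have hE := memLp_top_prim hwi
  have hEi : MemLp (fun x => prim w x ^ 2) ∞ muOmega := by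
    simpa only [sq] using hE.mul' hE
  have hb' := hc.b_mem.memLp_weakDeriv
  obtain ⟨k, hk⟩ := hc.b_mem.hasWeakDeriv.exists_ae_eq_prim (hb'.integrable le_top)
  -- `H` is the derivative of `prim w ^ 2`, in the shape delivered by the product rule. Since `prim
  -- w` vanishes at both ends, $\int b\,(E^2)'=-\int b'E^2$ has no boundary terms; this produces
  -- $c-\frac12b'$.
  set H : ℝ → ℝ := fun x => (0 + prim w x) * w x + (0 + prim w x) * w x with hH
  have hEw : Integrable (fun x => prim w x * w x) muOmega := integrable_mul_of_memLp_top hE hwi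
  have hHi : Integrable H muOmega := by
    simp only [hH, zero_add]
    exact hEw.add hEw
  have hsq : ∀ x ∈ Icc (0 : ℝ) 1, prim H x = prim w x ^ 2 := fun x hx => by
    have := prim_product hwi hwi 0 0 hx
    simp only [zero_add, mul_zero] at this
    rw [sq, this]
    simp [hH]
  have hibp := integral_prim_mul (hb'.integrable le_top) hHi k 0
  rw [hsq 1 one_mem_unitInterval, h1] at hibp
  have e1 : ∫ x in Omega, (k + prim (weakDeriv b) x) * H x
      = 2 * ∫ x in Omega, prim w x * (b x * w x) := by
    rw [← integral_const_mul]
    refine integral_congr_ae (hk.mono fun x hx => ?_)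
    simp only [hH, ← hx]
    ring
  have e2 : ∫ x in Omega, (0 + prim H x) * weakDeriv b x
      = 2 * ∫ x in Omega, 1 / 2 * weakDeriv b x * prim w x ^ 2 := by
    rw [← integral_const_mul]
    refine integral_congr_ae (ae_muOmega_of_forall fun x hx => ?_)
    simp only [hsq x (Omega_subset_Icc hx)]
    ring
  rw [e1, e2] at hibp
  have i1 : Integrable (fun x => a x * w x ^ 2) muOmega :=
    integrable_mul_of_memLp_top hc.a_mem.1 hw.integrable_sq
  have i2 : Integrable (fun x => prim w x * (b x * w x)) muOmega :=
    integrable_mul_of_memLp_top hE (integrable_mul_of_memLp_top hc.b_mem.1 hwi)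
  have i3 : Integrable (fun x => c x * prim w x ^ 2) muOmega :=
    integrable_mul_of_memLp_top hc.c_mem (hEi.integrable le_top)
  have i4 : Integrable (fun x => 1 / 2 * weakDeriv b x * prim w x ^ 2) muOmega :=
    integrable_mul_of_memLp_top (hb'.const_mul _) (hEi.integrable le_top)
  have e3 : ∫ x in Omega, (a x * w x ^ 2 + prim w x * (b x * w x + c x * prim w x))
      = (∫ x in Omega, a x * w x ^ 2) + ∫ x in Omega, (c x - 1 / 2 * weakDeriv b x) *
        prim w x ^ 2 := by
    have : ∀ x, a x * w x ^ 2 + prim w x * (b x * w x + c x * prim w x)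
      = a x * w x ^ 2 + (prim w x * (b x * w x) + c x * prim w x ^ 2) := fun x => by ring
    simp only [this, sub_mul]
    have i23 : Integrable (fun x => prim w x * (b x * w x) + c x * prim w x ^ 2) muOmega :=
      i2.add i3
    rw [integral_add i1 i23, integral_add i2 i3, integral_sub i3 i4]
    linarith
  rw [e3, ← integral_const_mul]
  have p1 : ∫ x in Omega, a₀ * w x ^ 2 ≤ ∫ x in Omega, a x * w x ^ 2 :=
    integral_mono_ae (hw.integrable_sq.const_mul _) i1 (hc.elliptic.mono fun x hx =>
      mul_le_mul_of_nonneg_right hx (sq_nonneg _))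
  have p2 : 0 ≤ ∫ x in Omega, (c x - 1 / 2 * weakDeriv b x) * prim w x ^ 2 :=
    integral_nonneg_of_ae (hc.coercive.mono fun x hx => mul_nonneg hx (sq_nonneg _))
  linarith

theorem integrable_lower_order (hc : Coefficients a₀ a b c) {w : ℝ → ℝ}
    (hw : Integrable w muOmega) : Integrable (fun x => b x * w x + c x * prim w x) muOmega :=
  (integrable_mul_of_memLp_top hc.b_mem.1 hw).add
    (integrable_mul_of_memLp_top hc.c_mem ((memLp_top_prim hw).integrable le_top))

/-- The energy estimate for the once integrated equation. -/
theorem energy_estimate (hc : Coefficients a₀ a b c) {w R : ℝ → ℝ} {k : ℝ}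
    (hw : MemLp w 2 muOmega) (h1 : prim w 1 = 0) (hR : MemLp R 2 muOmega)
    (heq : ∀ᵐ x ∂muOmega, a x * w x = k + R x + prim (fun t => b t * w t + c t * prim w t) x) :
    a₀ ^ 2 * ∫ x in Omega, w x ^ 2 ≤ ∫ x in Omega, R x ^ 2 := by
  have hwi := MemLp.integrable_of_two hw
  set g : ℝ → ℝ := fun t => b t * w t + c t * prim w t with hg
  have hgi : Integrable g muOmega := hc.integrable_lower_order hwi
  -- Multiplying the equation by `w`, the constant `k` drops out because `w` has mean zero, and the
  -- primitive of `g` turns into $-\int(\mathrm{prim}\,w)\,g$. This cancels the lower-order part of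
  -- the coercivity estimate and leaves only $\int Rw$.
  have hibp := integral_prim_mul hgi hwi k 0
  simp only [h1, zero_add, mul_zero, sub_zero, zero_sub] at hibp
  have i1 : Integrable (fun x => a x * w x ^ 2) muOmega :=
    integrable_mul_of_memLp_top hc.a_mem.1 hw.integrable_sq
  have i2 : Integrable (fun x => prim w x * g x) muOmega :=
    integrable_mul_of_memLp_top (memLp_top_prim hwi) hgi
  have i3 := integrable_mul_of_memLp_two hR hw
  have i4 : Integrable (fun x => (k + prim g x) * w x) muOmega :=
    integrable_mul_of_memLp_top (memLp_top_const_add_prim hgi k) hwi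
  have e1 : ∫ x in Omega, a x * w x ^ 2
      = (∫ x in Omega, R x * w x) + ∫ x in Omega, (k + prim g x) * w x := by
    rw [← integral_add i3 i4]
    refine integral_congr_ae (heq.mono fun x hx => ?_)
    have : a x * w x ^ 2 = (a x * w x) * w x := by ring
    simp only [this, hx]
    ring
  have hco := hc.coercivity hw h1
  rw [integral_add i1 i2, e1, hibp] at hco
  -- Young's inequality, weighted so that half of $2a_0^2\int w^2$ is absorbed.
  have hRw : 2 * a₀ * ∫ x in Omega, R x * w x
      ≤ (∫ x in Omega, R x ^ 2) + a₀ ^ 2 * ∫ x in Omega, w x ^ 2 := by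
    rw [← integral_const_mul, ← integral_const_mul,
      ← integral_add hR.integrable_sq (hw.integrable_sq.const_mul _)]
    refine integral_mono (i3.const_mul _) (hR.integrable_sq.add (hw.integrable_sq.const_mul _))
      fun x => ?_
    have := sq_nonneg (R x - a₀ * w x)
    simp only
    nlinarith
  have hpos := hc.pos
  nlinarith

/-- Stability with respect to an `L¹` perturbation: the part of the solution that is not controlled
pointwise by the data is controlled in `L²`. -/
theorem exists_stability (hc : Coefficients a₀ a b c) : ∃ C : ℝ, 1 ≤ C ∧
    ∀ (w R : ℝ → ℝ) (k : ℝ), MemLp w 2 muOmega → prim w 1 = 0 → MemLp R 2 muOmega →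
      (∀ᵐ x ∂muOmega, a x * w x = k + R x + prim (fun t => b t * w t + c t * prim w t) x) →
      ∃ d : ℝ → ℝ, MemLp d 2 muOmega ∧
        ∫ x in Omega, d x ^ 2 ≤ (C * ∫ x in Omega, |R x|) ^ 2 ∧
        ∀ᵐ x ∂muOmega, |w x| + |prim w x| ≤ C * (|R x| + ∫ x in Omega, |R x|) + |d x| := by
  obtain ⟨M, hM1, hM⟩ := hc.exists_bound
  have ha₀ := hc.pos
  have hM0 : 0 < M := by linarith
  -- With $J=\int|R|$, the solution splits as `w = p + d`; `A * J` will bound $\|p\|_{L^1}$ and `B *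
  -- J` will bound $\|d\|_{L^2}$. The final constant collects $1/a_0$ in front of $|R|$ and $2A+B$
  -- in front of $J$.
  set A := (1 + M / a₀) / a₀ with hA
  have hA0 : 0 < A := by positivity
  set B := 2 * M * A / a₀ with hB
  have hB0 : 0 < B := by positivity
  refine ⟨1 / a₀ + 2 * A + B + 1, by linarith [one_div_pos.2 ha₀],
    fun w R k hw h1 hR heq => ?_⟩
  have hwi := MemLp.integrable_of_two hw
  have hRi := MemLp.integrable_of_two hR
  set J := ∫ x in Omega, |R x| with hJ
  have hJ0 : 0 ≤ J := integral_nonneg fun x => abs_nonneg _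
  have hinv := hc.memLp_inv
  have iinv : Integrable (fun x => (a x)⁻¹) muOmega := hinv.integrable le_top
  have hS : 1 / M ≤ ∫ x in Omega, (a x)⁻¹ := by
    have : ∫ _ in Omega, 1 / M = 1 / M := by simp [Omega]
    rw [← this]
    refine integral_mono_ae (integrable_const _) iinv ?_
    filter_upwards [hM, hc.elliptic] with x hx hx'
    simp only [one_div]
    have : 0 < a x := ha₀.trans_le hx'
    gcongr
    exact (le_abs_self _).trans hx.1
  set S := ∫ x in Omega, (a x)⁻¹ with hSdef
  have hS0 : 0 < S := (one_div_pos.2 hM0).trans_le hS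
  have iRa : Integrable (fun x => (a x)⁻¹ * R x) muOmega := integrable_mul_of_memLp_top hinv hRi
  have hRa : |∫ x in Omega, (a x)⁻¹ * R x| ≤ J / a₀ := by
    refine abs_integral_le_integral_abs.trans ?_
    rw [div_eq_inv_mul, hJ, ← integral_const_mul]
    refine integral_mono_ae iRa.abs (hRi.abs.const_mul _) ?_
    filter_upwards [hc.elliptic] with x hx
    simp only [abs_mul, abs_inv, abs_of_pos (ha₀.trans_le hx)]
    gcongr
  -- `K` is the constant for which $p=(R-K)/a$, the solution for the principal part alone, has mean
  -- zero.
  set K := (∫ x in Omega, (a x)⁻¹ * R x) / S with hK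
  have hKb : |K| ≤ M / a₀ * J := by
    rw [hK, abs_div, abs_of_pos hS0, div_le_iff₀ hS0]
    refine hRa.trans ?_
    have : 1 ≤ M * S := by
      rw [div_le_iff₀ hM0] at hS
      linarith
    calc J / a₀ = J / a₀ * 1 := (mul_one _).symm
      _ ≤ J / a₀ * (M * S) := by gcongr
      _ = M / a₀ * J * S := by ring
  set p : ℝ → ℝ := fun x => (a x)⁻¹ * (R x - K) with hp
  have hp2 : MemLp p 2 muOmega := memLp_two_of_top_mul hinv (hR.sub (memLp_const K))
  have hpi := MemLp.integrable_of_two hp2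
  have hp1 : prim p 1 = 0 := by
    rw [← integral_muOmega]
    simp only [hp, mul_sub]
    rw [integral_sub iRa (iinv.mul_const K), integral_mul_const, ← hSdef, hK]
    field_simp
    simp
  have hpabs : ∀ᵐ x ∂muOmega, |p x| ≤ 1 / a₀ * (|R x| + M / a₀ * J) := by
    filter_upwards [hc.elliptic] with x hx
    simp only [hp, abs_mul, abs_inv, abs_of_pos (ha₀.trans_le hx), one_div]
    gcongr
    exact (abs_sub _ _).trans (by gcongr)
  have hpJ : ∫ x in Omega, |p x| ≤ A * J := by
    refine (integral_mono_ae hpi.abs ((hRi.abs.add (integrable_const _)).const_mul _)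
      hpabs).trans (le_of_eq ?_)
    rw [integral_const_mul]
    simp only [Pi.add_apply]
    rw [integral_add hRi.abs (integrable_const _), integral_const, probReal_univ, one_smul, ← hJ,
      hA]
    ring
  set d : ℝ → ℝ := fun x => w x - p x with hd
  have hd2 : MemLp d 2 muOmega := hw.sub hp2
  have hdi := MemLp.integrable_of_two hd2
  have hdprim : ∀ x ∈ Icc (0 : ℝ) 1, prim d x = prim w x - prim p x := fun x hx =>
    prim_sub hwi hpi hx
  have hd1 : prim d 1 = 0 := by rw [hdprim 1 one_mem_unitInterval, h1, hp1, sub_zero]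
  set gp : ℝ → ℝ := fun t => b t * p t + c t * prim p t with hgp
  have hgpi : Integrable gp muOmega := hc.integrable_lower_order hpi
  have hgdi := hc.integrable_lower_order hdi
  -- The remainder solves the same kind of equation with `R` replaced by the primitive `prim gp`.
  -- That is one integration smoother: its supremum is bounded by the $L^1$ norm of `R`, so the
  -- energy estimate bounds `d` by $J$.
  have hdeq : ∀ᵐ x ∂muOmega, a x * d x
      = (k + K) + prim gp x + prim (fun t => b t * d t + c t * prim d t) x := by
    filter_upwards [heq, hc.elliptic, ae_mem_Omega] with x hx hxa hxO
    have hxI := Omega_subset_Icc hxO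
    rw [add_assoc, ← prim_add hgpi hgdi hxI]
    have e : prim (fun t => gp t + (b t * d t + c t * prim d t)) x
        = prim (fun t => b t * w t + c t * prim w t) x := by
      refine prim_congr (ae_muOmega_of_forall fun t ht => ?_) hxI
      have h := hdprim t (Omega_subset_Icc ht)
      change b t * p t + c t * prim p t + (b t * (w t - p t) + c t * prim d t)
        = b t * w t + c t * prim w t
      rw [h]
      ring
    have ha : a x ≠ 0 := (ha₀.trans_le hxa).ne'
    rw [e]
    simp only [hd, hp, mul_sub, hx]
    field_simp
    ring
  have hR2 : MemLp (prim gp) 2 muOmega := MemLp.memLp_two_of_top (memLp_top_prim hgpi)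
  have hgpb : ∫ x in Omega, |gp x| ≤ 2 * M * (A * J) := by
    have h2 : ∫ x in Omega, |gp x| ≤ ∫ x in Omega, (M * |p x| + M * ∫ t in Omega, |p t|) := by
      refine integral_mono_ae hgpi.abs ((hpi.abs.const_mul M).add (integrable_const _)) ?_
      filter_upwards [hM, ae_mem_Omega] with x hx hxO
      have h := abs_prim_le hpi (Omega_subset_Icc hxO)
      calc |gp x| ≤ |b x * p x| + |c x * prim p x| := abs_add_le _ _
        _ = |b x| * |p x| + |c x| * |prim p x| := by rw [abs_mul (b x), abs_mul (c x)]
        _ ≤ M * |p x| + M * ∫ t in Omega, |p t| := by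
          gcongr
          · exact hx.2.1
          · exact hx.2.2.1
    rw [integral_add (hpi.abs.const_mul M) (integrable_const _), integral_const_mul,
      integral_const, probReal_univ, one_smul] at h2
    nlinarith
  have hen := hc.energy_estimate hd2 hd1 hR2 hdeq
  have hgp2 : ∫ x in Omega, prim gp x ^ 2 ≤ (2 * M * (A * J)) ^ 2 := by
    have : ∫ _ in Omega, (2 * M * (A * J)) ^ 2 = (2 * M * (A * J)) ^ 2 := by simp [Omega]
    rw [← this]
    refine integral_mono_ae hR2.integrable_sq (integrable_const _)
      (ae_muOmega_of_forall fun x hx => ?_)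
    simp only
    rw [← sq_abs]
    have := (abs_prim_le hgpi (Omega_subset_Icc hx)).trans hgpb
    gcongr
  have hdB : ∫ x in Omega, d x ^ 2 ≤ (B * J) ^ 2 := by
    have h2 : a₀ ^ 2 * ∫ x in Omega, d x ^ 2 ≤ a₀ ^ 2 * (B * J) ^ 2 := by
      refine (hen.trans hgp2).trans (le_of_eq ?_)
      rw [hB]
      field_simp
    exact le_of_mul_le_mul_left h2 (by positivity)
  have hdJ : ∫ x in Omega, |d x| ≤ B * J :=
    abs_le_of_sq_le_sq' ((sq_integral_abs_le hd2).trans hdB) (by positivity) |>.2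
  have hwJ : ∫ x in Omega, |w x| ≤ (A + B) * J := by
    have : ∫ x in Omega, |w x| ≤ ∫ x in Omega, (|p x| + |d x|) := by
      refine integral_mono hwi.abs (hpi.abs.add hdi.abs) fun x => ?_
      have : w x = p x + d x := by simp [hd]
      simp only
      rw [this]
      exact abs_add_le _ _
    rw [integral_add hpi.abs hdi.abs] at this
    linarith
  refine ⟨d, hd2, hdB.trans ?_, ?_⟩
  · have : B ≤ 1 / a₀ + 2 * A + B + 1 := by linarith [one_div_pos.2 ha₀]
    gcongr
  · filter_upwards [hpabs, ae_mem_Omega] with x hx hxO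
    have e1 := (abs_prim_le hwi (Omega_subset_Icc hxO)).trans hwJ
    have e2 : |w x| ≤ |p x| + |d x| := by
      have : w x = p x + d x := by simp [hd]
      rw [this]
      exact abs_add_le _ _
    have e3 : 1 / a₀ * (M / a₀ * J) ≤ A * J := by
      rw [hA, ← mul_assoc]
      gcongr
      rw [div_mul_eq_mul_div, one_mul]
      gcongr
      linarith
    have e4 : 0 ≤ (2 * A + B + 1) * |R x| := by positivity
    have e5 : 0 ≤ (1 / a₀ + 1) * J := by positivity
    nlinarith

end Coefficients

/-! ### Galerkin orthogonality and the integrated residual. -/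

section Galerkin

variable {a₀ : ℝ} {a b c f u uh : ℝ → ℝ} {N : ℕ}

theorem hasWeakDeriv_of_eq_prim {v w : ℝ → ℝ} (hw : Integrable w muOmega)
    (hv : ∀ x ∈ Icc (0 : ℝ) 1, v x = prim w x) : HasWeakDeriv v w :=
  hasWeakDeriv_of_ae_eq_prim (k := 0) hw
    (ae_muOmega_of_forall fun x hx => by rw [hv x (Omega_subset_Icc hx), zero_add])

/-- The flux of a weak solution is a primitive. -/
theorem IsWeakSolution.exists_flux_eq (hc : Coefficients a₀ a b c) (hf : MemLp f 2 muOmega)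
    (hu : IsWeakSolution a b c f u) :
    ∃ k, ∀ᵐ x ∂muOmega, a x * weakDeriv u x
      = k + prim (fun t => b t * weakDeriv u t + c t * u t - f t) x := by
  have hw2 := hu.1.memLp_weakDeriv
  have i1 : Integrable (fun t => b t * weakDeriv u t) muOmega :=
    integrable_mul_of_memLp_top hc.b_mem.1 (MemLp.integrable_of_two hw2)
  have i2 : Integrable (fun t => c t * u t) muOmega :=
    integrable_mul_of_memLp_top hc.c_mem (MemLp.integrable_of_two hu.1.1.1)
  have i3 : Integrable (fun t => b t * weakDeriv u t + c t * u t) muOmega := i1.add i2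
  have i4 := MemLp.integrable_of_two hf
  have i5 : Integrable (fun t => b t * weakDeriv u t + c t * u t - f t) muOmega := i3.sub i4
  have i6 : Integrable (fun t => a t * weakDeriv u t) muOmega :=
    integrable_mul_of_memLp_top hc.a_mem.1 (MemLp.integrable_of_two hw2)
  refine HasWeakDeriv.exists_ae_eq_prim (w := fun t => b t * weakDeriv u t + c t * u t - f t)
    ⟨Integrable.locallyIntegrableOn_Omega i6, Integrable.locallyIntegrableOn_Omega i5,
      fun φ hφ => ?_⟩ i5
  have h := hu.2 φ hφ.memH10
  have j1 : Integrable (fun t => a t * weakDeriv u t * deriv φ t) muOmega :=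
    hφ.deriv.integrable_locallyIntegrableOn_mul (Integrable.locallyIntegrableOn_Omega i6)
  have j2 : Integrable (fun t => (b t * weakDeriv u t + c t * u t) * φ t) muOmega :=
    hφ.integrable_locallyIntegrableOn_mul (Integrable.locallyIntegrableOn_Omega i3)
  have j3 : Integrable (fun t => f t * φ t) muOmega :=
    hφ.integrable_locallyIntegrableOn_mul (Integrable.locallyIntegrableOn_Omega i4)
  have e : bilin a b c u φ = (∫ x in Omega, a x * weakDeriv u x * deriv φ x)
      + ∫ x in Omega, (b x * weakDeriv u x + c x * u x) * φ x := by
    rw [bilin, ← integral_add j1 j2]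
    refine integral_congr_ae (hφ.hasWeakDeriv.weakDeriv_ae_eq.mono fun x hx => ?_)
    simp only [hx]
    ring
  simp only [sub_mul]
  rw [integral_sub j2 j3]
  rw [e, pairing] at h
  linarith

theorem pdeResidual_ae_eq {v w : ℝ → ℝ} (h : weakDeriv v =ᵐ[muOmega] w) :
    pdeResidual a b c f v =ᵐ[muOmega]
      fun x => f x + weakDeriv a x * w x - b x * w x - c x * v x :=
  h.mono fun x hx => by simp only [pdeResidual, hx]

theorem memLp_pdeResidual (hc : Coefficients a₀ a b c) (hf : MemLp f 2 muOmega) {v w : ℝ → ℝ}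
    (h : weakDeriv v =ᵐ[muOmega] w) (hw : MemLp w 2 muOmega) (hv : MemLp v 2 muOmega) :
    MemLp (pdeResidual a b c f v) 2 muOmega :=
  (memLp_congr_ae (pdeResidual_ae_eq h)).2
    (((hf.add (memLp_two_of_top_mul hc.a_mem.memLp_weakDeriv hw)).sub
      (memLp_two_of_top_mul hc.b_mem.1 hw)).sub (memLp_two_of_top_mul hc.c_mem hv))

namespace Mesh

variable {π : Mesh N}

theorem integrableOn_cell {g : ℝ → ℝ} (hg : Integrable g muOmega) {i : ℕ} (hi : i < N) :
    IntegrableOn g (π.cell i) :=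
  IntegrableOn.mono_set (t := Omega) hg (π.cell_subset hi)

theorem ae_cell {p : ℝ → Prop} (h : ∀ᵐ x ∂muOmega, p x) {i : ℕ} (hi : i < N) :
    ∀ᵐ x ∂volume.restrict (π.cell i), p x :=
  ae_restrict_of_ae_restrict_of_subset (π.cell_subset hi) h

theorem volume_real_cell {i : ℕ} (hi : i < N) : volume.real (π.cell i) = π.len i := by
  simp [cell, len, (π.x_lt i hi).le]

/-- A function deviates from its mean over a cell by at most its oscillation. -/
theorem abs_sub_mean_le {g : ℝ → ℝ} {V : ℝ} {i : ℕ} (hi : i < N)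
    (hg : IntegrableOn g (π.cell i)) (hV : ∀ x ∈ π.cell i, ∀ y ∈ π.cell i, |g x - g y| ≤ V)
    {x : ℝ} (hx : x ∈ π.cell i) : |g x - 1 / π.len i * ∫ y in π.cell i, g y| ≤ V := by
  have hl := π.len_pos hi
  have hvol := volume_real_cell (π := π) hi
  have hfin : volume (π.cell i) < ⊤ := by simp [cell]
  have h1 : ∫ y in π.cell i, (g x - g y) = π.len i * g x - ∫ y in π.cell i, g y := by
    have hconst : IntegrableOn (fun _ : ℝ => g x) (π.cell i) := integrableOn_const hfin.ne
    rw [integral_sub hconst hg, setIntegral_const, hvol, smul_eq_mul]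
  have h2 : |∫ y in π.cell i, (g x - g y)| ≤ V * π.len i := by
    rw [← hvol]
    exact norm_setIntegral_le_of_norm_le_const (f := fun y => g x - g y) hfin fun y hy => hV x hx y hy
  have h3 : g x - 1 / π.len i * ∫ y in π.cell i, g y
      = (∫ y in π.cell i, (g x - g y)) / π.len i := by
    rw [h1]
    field_simp
  rw [h3, abs_div, abs_of_pos hl, div_le_iff₀ hl]
  exact h2

/-- A hat function vanishes at both ends, so integration by parts moves the load and the lower-order
terms onto its slope. The discrete equation then involves slopes only, and these are step functions.
-/
theorem IsFESolution.integral_flux_mul_hatSlope (hc : Coefficients a₀ a b c)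
    (hf : MemLp f 2 muOmega) (h : π.IsFESolution a b c f uh) {s : ℝ → ℝ} (hs : MemLp s ∞ muOmega)
    (hus : weakDeriv uh =ᵐ[muOmega] s)
    (hg : Integrable (fun t => f t - b t * s t - c t * uh t) muOmega) {i : ℕ} (hi : i ∈ Ioo 0 N) :
    ∫ x in Omega, (-(a x * s x) - prim (fun t => f t - b t * s t - c t * uh t) x)
      * π.hatSlope i x = 0 := by
  obtain ⟨h1, h2⟩ := π.hat_eq_prim hi
  have hp := (π.memLp_hatSlope i)
  have hpi := hp.integrable le_top
  have hweak := (hasWeakDeriv_of_eq_prim hpi h1).weakDeriv_ae_eq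
  have hFE := h.2 (π.hat i) (Submodule.subset_span ⟨i, hi, rfl⟩)
  set g : ℝ → ℝ := fun t => f t - b t * s t - c t * uh t with hgdef
  have hibp := integral_prim_mul hg hpi 0 0
  simp only [zero_add, mul_zero, sub_zero, ← h1 1 one_mem_unitInterval, h2, zero_sub] at hibp
  have hhat := memLp_top_prim hpi
  have i1 : Integrable (fun x => a x * (s x * π.hatSlope i x)) muOmega :=
    integrable_mul_of_memLp_top hc.a_mem.1 (integrable_mul_of_memLp_top hs hpi)
  have i2 : Integrable (fun x => prim g x * π.hatSlope i x) muOmega :=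
    integrable_mul_of_memLp_top (memLp_top_prim hg) hpi
  have i3 : Integrable (fun x => prim (π.hatSlope i) x * g x) muOmega :=
    integrable_mul_of_memLp_top hhat hg
  have i4 : Integrable (fun x => prim (π.hatSlope i) x * f x) muOmega :=
    integrable_mul_of_memLp_top hhat (MemLp.integrable_of_two hf)
  have e1 : pairing f (π.hat i) - bilin a b c uh (π.hat i)
      = (∫ x in Omega, prim (π.hatSlope i) x * g x)
        - ∫ x in Omega, a x * (s x * π.hatSlope i x) := by
    have p1 : pairing f (π.hat i) = ∫ x in Omega, prim (π.hatSlope i) x * f x :=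
      integral_congr_ae (ae_muOmega_of_forall fun x hx => by
        simp only [h1 x (Omega_subset_Icc hx), mul_comm])
    have i5 : Integrable (fun x => prim (π.hatSlope i) x * f x - prim (π.hatSlope i) x * g x)
        muOmega := i4.sub i3
    have p2 : bilin a b c uh (π.hat i) = (∫ x in Omega, a x * (s x * π.hatSlope i x))
        + ∫ x in Omega, (prim (π.hatSlope i) x * f x - prim (π.hatSlope i) x * g x) := by
      rw [bilin, ← integral_add i1 i5]
      refine integral_congr_ae ?_
      filter_upwards [hus, hweak, ae_mem_Omega] with x k1 k2 k3
      simp only [k1, k2, h1 x (Omega_subset_Icc k3), hgdef]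
      ring
    rw [p1, p2, integral_sub i4 i3]
    ring
  have e2 : ∫ x in Omega, (-(a x * s x) - prim g x) * π.hatSlope i x
      = -(∫ x in Omega, a x * (s x * π.hatSlope i x))
        - ∫ x in Omega, prim g x * π.hatSlope i x := by
    have i1' : Integrable (fun x => -(a x * (s x * π.hatSlope i x))) muOmega := i1.neg
    rw [← integral_neg, ← integral_sub i1' i2]
    congr 1
    ext x
    ring
  rw [e2, hibp]
  linarith

/-- If `T` is orthogonal to the slopes of the hat functions, its cell means are all equal. -/
theorem exists_mean_eq {T : ℝ → ℝ} (hT : Integrable T muOmega)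
    (h : ∀ i ∈ Ioo 0 N, ∫ x in Omega, T x * π.hatSlope i x = 0) :
    ∃ K, ∀ i < N, 1 / π.len i * ∫ x in π.cell i, T x = K := by
  have key : ∀ j < N, ∀ k : ℝ, Integrable (fun x => T x * (π.cell j).indicator (fun _ => k) x)
      muOmega ∧ ∫ x in Omega, T x * (π.cell j).indicator (fun _ => k) x
        = k * ∫ x in π.cell j, T x := by
    intro j hj k
    have e : (fun x => T x * (π.cell j).indicator (fun _ => k) x)
        = (π.cell j).indicator (fun x => k * T x) := by
      ext x
      by_cases hx : x ∈ π.cell j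
      · simp only [indicator_of_mem hx, mul_comm]
      · simp only [indicator_of_notMem hx, mul_zero]
    rw [e]
    refine ⟨(hT.const_mul k).indicator (π.measurableSet_cell j), ?_⟩
    rw [setIntegral_indicator (π.measurableSet_cell j), inter_eq_right.2 (π.cell_subset hj),
      integral_const_mul]
  refine ⟨1 / π.len 0 * ∫ x in π.cell 0, T x, fun i hi => ?_⟩
  induction i with
  | zero => rfl
  | succ j ih =>
    rw [← ih (by omega)]
    -- The slope of the hat at `x (j + 1)` is `1 / len j` on cell `j` and `-1 / len (j + 1)` on the
    -- next cell; orthogonality to it equates the two neighbouring means.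
    have h1 := h (j + 1) ⟨Nat.succ_pos j, hi⟩
    simp only [hatSlope, mul_sub, Nat.add_sub_cancel] at h1
    rw [integral_sub (key j (by omega) _).1 (key (j + 1) hi _).1, (key j (by omega) _).2,
      (key (j + 1) hi _).2] at h1
    linarith

/-- The Galerkin residual of a finite element solution, as the derivative of a function `R` that is
controlled cellwise by the residual. -/
theorem IsFESolution.exists_residual_potential (hc : Coefficients a₀ a b c)
    (hf : MemLp f 2 muOmega) (h : π.IsFESolution a b c f uh) :
    ∃ (s R : ℝ → ℝ) (K : ℝ), MemLp s ∞ muOmega ∧ weakDeriv uh =ᵐ[muOmega] s ∧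
      (∀ x ∈ Icc (0 : ℝ) 1, uh x = prim s x) ∧ prim s 1 = 0 ∧ MemLp R 2 muOmega ∧
      (∀ x, R x = -(a x * s x) - prim (fun t => f t - b t * s t - c t * uh t) x - K) ∧
      ∀ i < N, ∀ᵐ x ∂muOmega, x ∈ π.cell i →
        |R x| ≤ ∫ t in π.cell i, |pdeResidual a b c f uh t| := by
  obtain ⟨s, σ, hs, hσ, hprim, hs1⟩ := π.exists_slope h.1
  have hsi : Integrable s muOmega := hs.integrable le_top
  have hus := (hasWeakDeriv_of_eq_prim hsi hprim).weakDeriv_ae_eq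
  have huh : MemLp uh 2 muOmega :=
    (memLp_congr_ae (ae_muOmega_of_forall fun x hx => hprim x (Omega_subset_Icc hx))).2
      (MemLp.memLp_two_of_top (memLp_top_prim hsi))
  have hs2 := MemLp.memLp_two_of_top hs
  set g : ℝ → ℝ := fun t => f t - b t * s t - c t * uh t with hg
  have hgi : Integrable g muOmega := MemLp.integrable_of_two
    ((hf.sub (memLp_two_of_top_mul hc.b_mem.1 hs2)).sub (memLp_two_of_top_mul hc.c_mem huh))
  have hrh : Integrable (pdeResidual a b c f uh) muOmega :=
    MemLp.integrable_of_two (memLp_pdeResidual hc hf hus hs2 huh)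
  set T : ℝ → ℝ := fun x => -(a x * s x) - prim g x with hT
  have hT2 : MemLp T 2 muOmega :=
    (memLp_two_of_top_mul hc.a_mem.1 hs2).neg.sub (MemLp.memLp_two_of_top (memLp_top_prim hgi))
  obtain ⟨K, hK⟩ := exists_mean_eq (π := π) (MemLp.integrable_of_two hT2) fun i hi =>
    h.integral_flux_mul_hatSlope hc hf hs hus hgi hi
  refine ⟨s, fun x => T x - K, K, hs, hus, hprim, hs1, hT2.sub (memLp_const K), fun x => rfl,
    fun i hi => ?_⟩
  have ha' := hc.a_mem.memLp_weakDeriv.integrable le_top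
  obtain ⟨k, hk⟩ := hc.a_mem.hasWeakDeriv.exists_ae_eq_prim ha'
  -- On one cell the slope is the constant `σ i`. Replacing `a` by its absolutely continuous
  -- representative gives a version `G` of `T` with derivative $-r_h$, for which oscillation bounds
  -- hold at every point.
  set G : ℝ → ℝ := fun x => -((k + prim (weakDeriv a) x) * σ i) - prim g x with hG
  have hGi : IntegrableOn G (π.cell i) := by
    refine integrableOn_cell ?_ hi
    exact ((((memLp_top_const_add_prim ha' k).integrable le_top).mul_const _).neg).sub
      ((memLp_top_prim hgi).integrable le_top)
  have hTG : ∀ᵐ x ∂muOmega, x ∈ π.cell i → T x = G x := by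
    filter_upwards [hk] with x hx hxc
    simp only [hT, hG, hx, hσ i hi x hxc]
  have hmean : ∫ x in π.cell i, T x = ∫ x in π.cell i, G x := by
    refine integral_congr_ae ?_
    filter_upwards [ae_cell hTG hi, ae_restrict_mem (π.measurableSet_cell i)] with x hx hxc
    exact hx hxc
  have hosc : ∀ x ∈ π.cell i, ∀ y ∈ π.cell i,
      |G x - G y| ≤ ∫ t in π.cell i, |pdeResidual a b c f uh t| := by
    intro x hx y hy
    have hx1 := Omega_subset_Icc (π.cell_subset hi hx)
    have hy1 := Omega_subset_Icc (π.cell_subset hi hy)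
    have hsub : uIoc x y ⊆ π.cell i := fun t ht => by
      have h1 := uIoc_subset_uIcc ht
      exact (ordConnected_Ioo.uIcc_subset hx hy) h1
    have e : G x - G y = ∫ t in x..y, pdeResidual a b c f uh t := by
      have e1 := prim_sub_prim ha' hx1 hy1
      have e2 := prim_sub_prim hgi hx1 hy1
      have e3 : ∫ t in x..y, pdeResidual a b c f uh t
          = ∫ t in x..y, (σ i * weakDeriv a t + g t) := by
        refine intervalIntegral.integral_congr_ae ?_
        have := (ae_restrict_iff' measurableSet_Omega).1 (pdeResidual_ae_eq (a := a) (b := b)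
          (c := c) (f := f) hus)
        filter_upwards [this] with t ht htm
        rw [ht (π.cell_subset hi (hsub htm)), hσ i hi t (hsub htm), hg]
        simp only [hσ i hi t (hsub htm)]
        ring
      rw [e3, intervalIntegral.integral_add
        ((Integrable.intervalIntegrable_of_mem ha' hx1 hy1).const_mul _)
        (Integrable.intervalIntegrable_of_mem hgi hx1 hy1),
        intervalIntegral.integral_const_mul, ← e1, ← e2, hG]
      ring
    rw [e]
    have h1 : |∫ t in x..y, pdeResidual a b c f uh t|
        ≤ ∫ t in uIoc x y, |pdeResidual a b c f uh t| :=
      intervalIntegral.norm_integral_le_integral_norm_uIoc (f := pdeResidual a b c f uh)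
        (μ := volume)
    exact h1.trans (setIntegral_mono_set (integrableOn_cell hrh.abs hi)
      (Eventually.of_forall fun t => abs_nonneg _) hsub.eventuallyLE)
  filter_upwards [hTG] with x hx hxc
  have := abs_sub_mean_le hi hGi hosc hxc
  rw [← hmean, hK i hi] at this
  rwa [hx hxc]

end Mesh

/-- The error estimates that do not involve the adaptation function. -/
theorem Coefficients.exists_error_estimate (hc : Coefficients a₀ a b c) : ∃ C : ℝ, 1 ≤ C ∧
    ∀ f u : ℝ → ℝ, MemLp f 2 muOmega → IsWeakSolution a b c f u →
      MemLp (pdeResidual a b c f u) 2 muOmega ∧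
      ∀ (N : ℕ) (π : Mesh N) (uh : ℝ → ℝ), π.IsFESolution a b c f uh →
        MemLp (pdeResidual a b c f uh) 2 muOmega ∧ MemLp (weakDeriv (u - uh)) 2 muOmega ∧
        ∃ R d : ℝ → ℝ, MemLp R 2 muOmega ∧ MemLp d 2 muOmega ∧
          (∀ i < N, ∀ᵐ x ∂muOmega, x ∈ π.cell i →
            |R x| ≤ ∫ t in π.cell i, |pdeResidual a b c f uh t|) ∧
          ∫ x in Omega, weakDeriv (u - uh) x ^ 2 ≤ C ^ 2 * ∫ x in Omega, R x ^ 2 ∧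
          ∫ x in Omega, d x ^ 2 ≤ (C * ∫ x in Omega, |R x|) ^ 2 ∧
          ∀ᵐ x ∂muOmega, |pdeResidual a b c f u x - pdeResidual a b c f uh x|
            ≤ C * (|R x| + ∫ x in Omega, |R x|) + |d x| := by
  obtain ⟨C, hC1, hC⟩ := hc.exists_stability
  obtain ⟨M, hM1, hM⟩ := hc.exists_bound
  have ha₀ := hc.pos
  have hC' : C * (2 * M) ≤ C * (2 * M) + 1 / a₀ := by
    have := one_div_pos.2 ha₀
    linarith
  -- The summand $1/a_0$ serves the energy estimate, and `C * (2 * M)` the bound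
  -- $|r-r_h|\le2M(|w|+|E|)$.
  refine ⟨C * (2 * M) + 1 / a₀, by nlinarith [one_div_pos.2 ha₀], fun f u hf hu => ?_⟩
  obtain ⟨hup, hu1⟩ := hu.1.ae_eq_prim
  have hw2 := hu.1.memLp_weakDeriv
  have hwi := MemLp.integrable_of_two hw2
  refine ⟨memLp_pdeResidual hc hf EventuallyEq.rfl hw2 hu.1.1.1, fun N π uh h => ?_⟩
  obtain ⟨s, R, K, hs, hus, hprim, hs1, hR, hRe, hRb⟩ := h.exists_residual_potential hc hf
  have hsi : Integrable s muOmega := hs.integrable le_top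
  have hs2 := MemLp.memLp_two_of_top hs
  have huh : MemLp uh 2 muOmega :=
    (memLp_congr_ae (ae_muOmega_of_forall fun x hx => hprim x (Omega_subset_Icc hx))).2
      (MemLp.memLp_two_of_top (memLp_top_prim hsi))
  obtain ⟨k, hk⟩ := hu.exists_flux_eq hc hf
  set w : ℝ → ℝ := fun x => weakDeriv u x - s x with hw
  have hwe2 : MemLp w 2 muOmega := hw2.sub hs2
  have hwei := MemLp.integrable_of_two hwe2
  have hpw : ∀ x ∈ Icc (0 : ℝ) 1, prim w x = prim (weakDeriv u) x - prim s x := fun x hx =>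
    prim_sub hwi hsi hx
  have hw1 : prim w 1 = 0 := by rw [hpw 1 one_mem_unitInterval, hu1, hs1, sub_zero]
  have hE : ∀ᵐ x ∂muOmega, u x - uh x = prim w x := by
    filter_upwards [hup, ae_mem_Omega] with x hx hxO
    rw [hx, hprim x (Omega_subset_Icc hxO), hpw x (Omega_subset_Icc hxO)]
  have hweak : weakDeriv (u - uh) =ᵐ[muOmega] w :=
    (hasWeakDeriv_of_ae_eq_prim (k := 0) hwei (hE.mono fun x hx => by
      rw [zero_add, ← hx, Pi.sub_apply])).weakDeriv_ae_eq
  -- The flux identity for `u` minus the definition of `R`: the data `f` cancel and only the error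
  -- remains.
  have heq : ∀ᵐ x ∂muOmega,
      a x * w x = (k + K) + R x + prim (fun t => b t * w t + c t * prim w t) x := by
    have j1 : Integrable (fun t => b t * weakDeriv u t + c t * u t - f t) muOmega :=
      MemLp.integrable_of_two (((memLp_two_of_top_mul hc.b_mem.1 hw2).add
        (memLp_two_of_top_mul hc.c_mem hu.1.1.1)).sub hf)
    have j2 : Integrable (fun t => f t - b t * s t - c t * uh t) muOmega :=
      MemLp.integrable_of_two ((hf.sub (memLp_two_of_top_mul hc.b_mem.1 hs2)).sub
        (memLp_two_of_top_mul hc.c_mem huh))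
    filter_upwards [hk, ae_mem_Omega] with x hx hxO
    have e : prim (fun t => b t * w t + c t * prim w t) x
        = prim (fun t => b t * weakDeriv u t + c t * u t - f t) x
          + prim (fun t => f t - b t * s t - c t * uh t) x := by
      rw [← prim_add j1 j2 (Omega_subset_Icc hxO)]
      refine prim_congr ?_ (Omega_subset_Icc hxO)
      filter_upwards [hE] with t ht
      rw [← ht]
      simp only [hw]
      ring
    rw [e, hRe]
    simp only [hw, mul_sub, hx]
    ring
  obtain ⟨d, hd, hdb, hbd⟩ := hC w R (k + K) hwe2 hw1 hR heq
  have hen := hc.energy_estimate hwe2 hw1 hR heq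
  have hR0 : 0 ≤ ∫ x in Omega, R x ^ 2 := integral_nonneg fun x => sq_nonneg _
  have hJ0 : 0 ≤ ∫ x in Omega, |R x| := integral_nonneg fun x => abs_nonneg _
  refine ⟨memLp_pdeResidual hc hf hus hs2 huh, (memLp_congr_ae hweak).2 hwe2, R,
    fun x => 2 * M * d x, hR, hd.const_mul _, hRb, ?_, ?_, ?_⟩
  · rw [integral_congr_ae (hweak.mono fun x hx => show _ = w x ^ 2 by rw [hx])]
    have h1 : ∫ x in Omega, w x ^ 2 ≤ (1 / a₀) ^ 2 * ∫ x in Omega, R x ^ 2 := by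
      rw [one_div, inv_pow, ← div_eq_inv_mul, le_div_iff₀ (by positivity)]
      linarith
    refine h1.trans ?_
    gcongr
    nlinarith
  · have : ∀ x, (2 * M * d x) ^ 2 = (2 * M) ^ 2 * d x ^ 2 := fun x => by ring
    simp only [this]
    rw [integral_const_mul]
    calc (2 * M) ^ 2 * ∫ x in Omega, d x ^ 2
        ≤ (2 * M) ^ 2 * (C * ∫ x in Omega, |R x|) ^ 2 := by gcongr
      _ = (C * (2 * M) * ∫ x in Omega, |R x|) ^ 2 := by ring
      _ ≤ _ := by gcongr
  · filter_upwards [hbd, hM, pdeResidual_ae_eq (a := a) (b := b) (c := c) (f := f) hus, hE]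
      with x h1 h2 h3 h4
    have e : pdeResidual a b c f u x - pdeResidual a b c f uh x
        = weakDeriv a x * w x - b x * w x - c x * prim w x := by
      rw [h3, ← h4]
      simp only [pdeResidual, hw]
      ring
    have e1 : |weakDeriv a x * w x - b x * w x - c x * prim w x|
        ≤ M * |w x| + M * |w x| + M * |prim w x| := by
      refine (abs_sub _ _).trans (add_le_add ((abs_sub _ _).trans (add_le_add ?_ ?_)) ?_) <;>
      · rw [abs_mul]
        gcongr
        first | exact h2.2.2.2 | exact h2.2.1 | exact h2.2.2.1
    rw [e, abs_mul, abs_of_pos (by linarith : 0 < 2 * M)]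
    calc _ ≤ _ := e1
      _ ≤ 2 * M * (|w x| + |prim w x|) := by nlinarith [abs_nonneg (prim w x)]
      _ ≤ 2 * M * (C * (|R x| + ∫ x in Omega, |R x|) + |d x|) := by gcongr
      _ = C * (2 * M) * (|R x| + ∫ x in Omega, |R x|) + 2 * M * |d x| := by ring
      _ ≤ _ := by gcongr

end Galerkin

/-! ### Cell averages and the sums $\sum h_i\langle v\rangle_i^{2/3}$. -/

theorem normLp_eq_integral {p : ℝ≥0∞} (hp : p ≠ 0) (hp' : p ≠ ⊤) {v : ℝ → ℝ}
    (hv : MemLp v p muOmega) :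
    normLp p v = (∫ x in Omega, |v x| ^ p.toReal) ^ p.toReal⁻¹ := by
  rw [normLp, hv.eLpNorm_eq_integral_rpow_norm hp hp', ENNReal.toReal_ofReal]
  · rfl
  · positivity

namespace Mesh

variable {N : ℕ} (π : Mesh N)

/-- The normalized Lebesgue measure on a cell. -/
noncomputable def cellMeasure (i : ℕ) : Measure ℝ :=
  ENNReal.ofReal (1 / π.len i) • volume.restrict (π.cell i)

variable {π} {i : ℕ}

theorem isProbabilityMeasure_cellMeasure (hi : i < N) :
    IsProbabilityMeasure (π.cellMeasure i) := ⟨by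
  have h := π.len_pos hi
  rw [cellMeasure, Measure.smul_apply, Measure.restrict_apply_univ, cell, Real.volume_Ioo,
    smul_eq_mul, ← ENNReal.ofReal_mul (by positivity)]
  change ENNReal.ofReal (1 / π.len i * π.len i) = 1
  rw [one_div_mul_cancel h.ne', ENNReal.ofReal_one]⟩

theorem integral_cellMeasure (hi : i < N) (g : ℝ → ℝ) :
    ∫ x, g x ∂π.cellMeasure i = 1 / π.len i * ∫ x in π.cell i, g x := by
  have h := π.len_pos hi
  rw [cellMeasure, integral_smul_measure, ENNReal.toReal_ofReal (by positivity), smul_eq_mul]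

theorem ae_cellMeasure {p : ℝ → Prop} (hi : i < N) (h : ∀ᵐ x ∂muOmega, x ∈ π.cell i → p x) :
    ∀ᵐ x ∂π.cellMeasure i, p x := by
  refine Measure.ae_smul_measure ?_ _
  filter_upwards [ae_cell h hi, ae_restrict_mem (π.measurableSet_cell i)] with x h1 h2
  exact h1 h2

theorem memLp_cellMeasure {p : ℝ≥0∞} {v : ℝ → ℝ} (hi : i < N) (hv : MemLp v p muOmega) :
    MemLp v p (π.cellMeasure i) :=
  (hv.mono_measure (Measure.restrict_mono_set volume (π.cell_subset hi))).smul_measure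
    ENNReal.ofReal_ne_top

/-- Makes Minkowski's inequality and the monotonicity of $L^p$ norms in $p$ available for cell
averages, as the normalized measure is a probability measure. -/
theorem avg_eq {v : ℝ → ℝ} (hi : i < N) (hv : MemLp v 2 muOmega) :
    π.avg v i = (eLpNorm v 2 (π.cellMeasure i)).toReal := by
  rw [(memLp_cellMeasure hi hv).eLpNorm_eq_integral_rpow_norm (by norm_num) (by norm_num),
    ENNReal.toReal_ofReal (by positivity), integral_cellMeasure hi, avg, Real.sqrt_eq_rpow]
  simp

theorem avg_nonneg (v : ℝ → ℝ) (i : ℕ) : 0 ≤ π.avg v i := Real.sqrt_nonneg _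

theorem len_mul_avg_sq {v : ℝ → ℝ} (hi : i < N) :
    π.len i * π.avg v i ^ 2 = ∫ x in π.cell i, v x ^ 2 := by
  have h := π.len_pos hi
  rw [avg, Real.sq_sqrt]
  · simp only [sq_abs]
    field_simp
  · exact mul_nonneg (by positivity) (integral_nonneg fun x => by positivity)

theorem avg_le_add {v v₁ v₂ : ℝ → ℝ} (hi : i < N) (hv : MemLp v 2 muOmega)
    (h1 : MemLp v₁ 2 muOmega) (h2 : MemLp v₂ 2 muOmega)
    (h : ∀ᵐ x ∂muOmega, |v x| ≤ |v₁ x| + |v₂ x|) : π.avg v i ≤ π.avg v₁ i + π.avg v₂ i := by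
  have k1 := memLp_cellMeasure hi h1 (π := π)
  have k2 := memLp_cellMeasure hi h2 (π := π)
  rw [avg_eq hi hv, avg_eq hi h1, avg_eq hi h2,
    ← ENNReal.toReal_add k1.eLpNorm_ne_top k2.eLpNorm_ne_top]
  refine ENNReal.toReal_mono (ENNReal.add_ne_top.2 ⟨k1.eLpNorm_ne_top, k2.eLpNorm_ne_top⟩) ?_
  rw [← eLpNorm_norm v₁, ← eLpNorm_norm v₂]
  refine (eLpNorm_mono_ae (g := (fun x => ‖v₁ x‖) + fun x => ‖v₂ x‖) ?_).trans
    (eLpNorm_add_le k1.1.norm k2.1.norm (by norm_num))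
  filter_upwards [ae_cellMeasure hi (h.mono fun x hx _ => hx)] with x hx
  exact hx.trans (le_abs_self _)

theorem avg_le_of_bound {v : ℝ → ℝ} {k : ℝ} (hi : i < N) (hk : 0 ≤ k)
    (h : ∀ᵐ x ∂muOmega, x ∈ π.cell i → |v x| ≤ k) : π.avg v i ≤ k := by
  have := isProbabilityMeasure_cellMeasure (π := π) hi
  rw [avg, ← integral_cellMeasure hi]
  refine Real.sqrt_le_iff.2 ⟨hk, ?_⟩
  refine (integral_mono_of_nonneg (Eventually.of_forall fun x => by positivity)
    (integrable_const (k ^ 2)) ?_).trans (by simp)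
  filter_upwards [ae_cellMeasure hi h] with x hx
  gcongr

theorem integral_cell_abs_le {v : ℝ → ℝ} (hi : i < N) (hv : MemLp v 2 muOmega) :
    ∫ x in π.cell i, |v x| ≤ π.len i * π.avg v i := by
  have := isProbabilityMeasure_cellMeasure (π := π) hi
  have h := π.len_pos hi
  have hv' := memLp_cellMeasure hi hv (π := π)
  have h1 : ∫ x, |v x| ∂π.cellMeasure i ≤ π.avg v i := by
    rw [avg_eq hi hv]
    have e : ∫ x, |v x| ∂π.cellMeasure i = (eLpNorm v 1 (π.cellMeasure i)).toReal := by
      rw [eLpNorm_one_eq_lintegral_enorm]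
      exact integral_norm_eq_lintegral_enorm hv'.1
    rw [e]
    exact ENNReal.toReal_mono hv'.eLpNorm_ne_top
      (eLpNorm_le_eLpNorm_of_exponent_le (by norm_num) hv'.1)
  rw [integral_cellMeasure hi, one_div_mul_eq_div, div_le_iff₀ h] at h1
  linarith

/-- Monotonicity of $L^p$ (quasi-)norms from $p=2/3$ to $p=2$ on a probability space. -/
theorem integral_cell_rpow_le {v : ℝ → ℝ} (hi : i < N) (hv : MemLp v 2 muOmega) :
    ∫ x in π.cell i, |v x| ^ (2 / 3 : ℝ) ≤ π.len i * π.avg v i ^ (2 / 3 : ℝ) := by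
  have := isProbabilityMeasure_cellMeasure (π := π) hi
  have h := π.len_pos hi
  have hv' := memLp_cellMeasure hi hv (π := π)
  have hle : (2 / 3 : ℝ≥0∞) ≤ 2 := ENNReal.div_le_of_le_mul (by norm_num)
  have hv'' : MemLp v (2 / 3) (π.cellMeasure i) := hv'.mono_exponent hle
  have h1 : (∫ x, |v x| ^ (2 / 3 : ℝ) ∂π.cellMeasure i) ^ (3 / 2 : ℝ) ≤ π.avg v i := by
    rw [avg_eq hi hv]
    have e : (∫ x, |v x| ^ (2 / 3 : ℝ) ∂π.cellMeasure i) ^ (3 / 2 : ℝ)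
        = (eLpNorm v (2 / 3) (π.cellMeasure i)).toReal := by
      rw [hv''.eLpNorm_eq_integral_rpow_norm (by norm_num)
        (ENNReal.div_ne_top (by norm_num) (by norm_num)), ENNReal.toReal_ofReal (by positivity)]
      simp [ENNReal.toReal_div]
    rw [e]
    exact ENNReal.toReal_mono hv'.eLpNorm_ne_top
      (eLpNorm_le_eLpNorm_of_exponent_le hle hv'.1)
  have h0 : 0 ≤ ∫ x, |v x| ^ (2 / 3 : ℝ) ∂π.cellMeasure i :=
    integral_nonneg fun x => by positivity
  have h2 := Real.rpow_le_rpow (by positivity) h1 (by norm_num : (0 : ℝ) ≤ 2 / 3)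
  rw [← Real.rpow_mul h0] at h2
  norm_num at h2
  rw [integral_cellMeasure hi, one_div_mul_eq_div, div_le_iff₀ h] at h2
  linarith

variable (π) in
/-- The sum `∑ h_i ⟨v⟩_i^{2/3}`. -/
noncomputable def avgSum (v : ℝ → ℝ) : ℝ :=
  ∑ i ∈ Finset.range N, π.len i * π.avg v i ^ (2 / 3 : ℝ)

theorem alpha_eq (v : ℝ → ℝ) : π.alpha v = π.avgSum v ^ 3 := rfl

theorem avgSum_term_nonneg (v : ℝ → ℝ) (hi : i < N) :
    0 ≤ π.len i * π.avg v i ^ (2 / 3 : ℝ) :=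
  mul_nonneg (π.len_pos hi).le (Real.rpow_nonneg (avg_nonneg v i) _)

theorem avgSum_nonneg (v : ℝ → ℝ) : 0 ≤ π.avgSum v :=
  Finset.sum_nonneg fun _ hi => avgSum_term_nonneg v (Finset.mem_range.1 hi)

theorem sqrt_alpha (v : ℝ → ℝ) : √(π.alpha v) = π.avgSum v ^ (3 / 2 : ℝ) := by
  rw [alpha_eq, Real.sqrt_eq_rpow, ← Real.rpow_natCast, ← Real.rpow_mul (avgSum_nonneg v)]
  norm_num

/-- Minkowski on each cell, then subadditivity of $t\mapsto t^{2/3}$. This is why comparisons are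
made with the sum itself and not with its power $\sqrt{\alpha_h}$. -/
theorem avgSum_le_add {v v₁ v₂ : ℝ → ℝ} (hv : MemLp v 2 muOmega)
    (h1 : MemLp v₁ 2 muOmega) (h2 : MemLp v₂ 2 muOmega)
    (h : ∀ᵐ x ∂muOmega, |v x| ≤ |v₁ x| + |v₂ x|) :
    π.avgSum v ≤ π.avgSum v₁ + π.avgSum v₂ := by
  rw [avgSum, avgSum, avgSum, ← Finset.sum_add_distrib]
  refine Finset.sum_le_sum fun i hi => ?_
  rw [Finset.mem_range] at hi
  rw [← mul_add]
  refine mul_le_mul_of_nonneg_left ?_ (π.len_pos hi).le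
  refine (Real.rpow_le_rpow (avg_nonneg v i) (avg_le_add hi hv h1 h2 h) (by norm_num)).trans ?_
  exact Real.rpow_add_le_add_rpow (avg_nonneg _ _) (avg_nonneg _ _) (by norm_num) (by norm_num)

theorem avgSum_le_of_bound {v : ℝ → ℝ} {V : ℕ → ℝ} (hV : ∀ i < N, 0 ≤ V i)
    (h : ∀ i < N, ∀ᵐ x ∂muOmega, x ∈ π.cell i → |v x| ≤ V i) :
    π.avgSum v ≤ ∑ i ∈ Finset.range N, π.len i * V i ^ (2 / 3 : ℝ) := by
  refine Finset.sum_le_sum fun i hi => ?_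
  rw [Finset.mem_range] at hi
  have := π.len_pos hi
  have := avg_le_of_bound hi (hV i hi) (h i hi)
  have := avg_nonneg (π := π) v i
  gcongr

theorem avgSum_const_mul {k : ℝ} (hk : 0 ≤ k) (v : ℝ → ℝ) :
    π.avgSum (fun x => k * v x) = k ^ (2 / 3 : ℝ) * π.avgSum v := by
  rw [avgSum, avgSum, Finset.mul_sum]
  refine Finset.sum_congr rfl fun i _ => ?_
  have : π.avg (fun x => k * v x) i = k * π.avg v i := by
    have e : ∀ x, |k * v x| ^ 2 = k ^ 2 * |v x| ^ 2 := fun x => by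
      rw [sq_abs, sq_abs, mul_pow]
    rw [avg]
    simp only [e]
    rw [integral_const_mul, mul_left_comm, Real.sqrt_mul (sq_nonneg k), Real.sqrt_sq hk, avg]
  rw [this, Real.mul_rpow hk (avg_nonneg v i)]
  ring

/-- Jensen for the concave function $t^{1/3}$ with the cell lengths as weights, applied to $\langle
v\rangle_i^2$. -/
theorem avgSum_le_integral_sq {v : ℝ → ℝ} (hv : MemLp v 2 muOmega) :
    π.avgSum v ≤ (∫ x in Omega, v x ^ 2) ^ (1 / 3 : ℝ) := by
  have hcc := Real.concaveOn_rpow (p := 1 / 3) (by norm_num) (by norm_num)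
  have h := hcc.le_map_sum (t := Finset.range N) (w := fun i => π.len i)
    (p := fun i => π.avg v i ^ 2) (fun i hi => (π.len_pos (Finset.mem_range.1 hi)).le) π.sum_len
    (fun i _ => mem_Ici.2 (sq_nonneg _))
  simp only [smul_eq_mul] at h
  have e1 : ∑ i ∈ Finset.range N, π.len i * π.avg v i ^ 2 = ∫ x in Omega, v x ^ 2 := by
    rw [← π.sum_integral_cell hv.integrable_sq]
    exact Finset.sum_congr rfl fun i hi => len_mul_avg_sq (Finset.mem_range.1 hi)
  rw [e1] at h
  refine le_trans (le_of_eq (Finset.sum_congr rfl fun i _ => ?_)) h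
  rw [← Real.rpow_natCast, ← Real.rpow_mul (avg_nonneg v i)]
  norm_num

theorem integrable_abs_rpow {v : ℝ → ℝ} (hv : MemLp v 2 muOmega) :
    Integrable (fun x => |v x| ^ (2 / 3 : ℝ)) muOmega := by
  have hle : (2 / 3 : ℝ≥0∞) ≤ 2 := ENNReal.div_le_of_le_mul (by norm_num)
  have := (hv.mono_exponent hle).integrable_norm_rpow (by norm_num)
    (ENNReal.div_ne_top (by norm_num) (by norm_num))
  simpa [ENNReal.toReal_div] using this

theorem integral_rpow_le_avgSum {v : ℝ → ℝ} (hv : MemLp v 2 muOmega) :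
    ∫ x in Omega, |v x| ^ (2 / 3 : ℝ) ≤ π.avgSum v := by
  rw [← π.sum_integral_cell (integrable_abs_rpow hv)]
  exact Finset.sum_le_sum fun i hi => integral_cell_rpow_le (Finset.mem_range.1 hi) hv

/-! ### Consequences of quasi-equidistribution. -/

section QuasiEquidistributing

variable {v : ℝ → ℝ} {κ : ℝ}

theorem rpow_third_eq (v : ℝ → ℝ) (i : ℕ) :
    (1 / π.alpha v * π.avg v i ^ 2) ^ (1 / 3 : ℝ)
      = (π.avgSum v)⁻¹ * π.avg v i ^ (2 / 3 : ℝ) := by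
  have h0 := avgSum_nonneg (π := π) v
  rw [alpha_eq, one_div, ← inv_pow, Real.mul_rpow (by positivity) (by positivity),
    ← Real.rpow_natCast, ← Real.rpow_natCast, ← Real.rpow_mul (by positivity),
    ← Real.rpow_mul (avg_nonneg v i)]
  norm_num

theorem alpha_nonneg (v : ℝ → ℝ) : 0 ≤ π.alpha v := pow_nonneg (avgSum_nonneg v) 3

theorem one_le_rho (v : ℝ → ℝ) (i : ℕ) : 1 ≤ π.rho v i := by
  have := alpha_nonneg (π := π) v
  refine Real.one_le_rpow ?_ (by norm_num)
  have : 0 ≤ 1 / π.alpha v * π.avg v i ^ 2 := by positivity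
  linarith

theorem inv_mul_le_rho (v : ℝ → ℝ) (i : ℕ) :
    (π.avgSum v)⁻¹ * π.avg v i ^ (2 / 3 : ℝ) ≤ π.rho v i := by
  rw [← rpow_third_eq]
  have := alpha_nonneg (π := π) v
  exact Real.rpow_le_rpow (by positivity) (by linarith) (by norm_num)

theorem rho_le (v : ℝ → ℝ) (i : ℕ) :
    π.rho v i ≤ 1 + (π.avgSum v)⁻¹ * π.avg v i ^ (2 / 3 : ℝ) := by
  rw [← rpow_third_eq]
  have := alpha_nonneg (π := π) v
  refine (Real.rpow_add_le_add_rpow zero_le_one (by positivity) (by norm_num)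
    (by norm_num)).trans ?_
  rw [Real.one_rpow]

theorem one_le_sigma (v : ℝ → ℝ) : 1 ≤ π.sigma v := by
  rw [← π.sum_len]
  refine Finset.sum_le_sum fun i hi => ?_
  exact le_mul_of_one_le_left (π.len_pos (Finset.mem_range.1 hi)).le (one_le_rho v i)

/-- The normalization by $\alpha_h$ makes the two parts of $\rho_i$ contribute at most one each;
with inversion of zero giving zero, the degenerate case is included. -/
theorem sigma_le_two (v : ℝ → ℝ) : π.sigma v ≤ 2 := by
  have h : π.sigma v ≤ ∑ i ∈ Finset.range N,
      (π.len i + (π.avgSum v)⁻¹ * (π.len i * π.avg v i ^ (2 / 3 : ℝ))) := by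
    refine Finset.sum_le_sum fun i hi => ?_
    have := mul_le_mul_of_nonneg_right (rho_le (π := π) v i)
      (π.len_pos (Finset.mem_range.1 hi)).le
    linarith
  refine h.trans ?_
  rw [Finset.sum_add_distrib, π.sum_len, ← Finset.mul_sum]
  have : (π.avgSum v)⁻¹ * π.avgSum v ≤ 1 := inv_mul_le_one
  rw [avgSum] at this ⊢
  linarith

/-- The mean over the cells of $N\rho_ih_i/\sigma_h$ is one, and a maximum is at least the mean. -/
theorem IsQuasiEquidistributing.one_le (h : π.IsQuasiEquidistributing v κ) : 1 ≤ κ := by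
  have hs : 0 < π.sigma v := zero_lt_one.trans_le (one_le_sigma v)
  have hN : (0 : ℝ) < N := Nat.cast_pos.2 π.pos
  have h1 : ∑ i ∈ Finset.range N, N * π.rho v i * π.len i ≤ ∑ i ∈ Finset.range N, κ * π.sigma v :=
    Finset.sum_le_sum fun i hi => (div_le_iff₀ hs).1 (h i (Finset.mem_range.1 hi))
  simp only [mul_assoc] at h1
  rw [← Finset.mul_sum, Finset.sum_const, Finset.card_range, nsmul_eq_mul] at h1
  have h2 : π.sigma v ≤ κ * π.sigma v := le_of_mul_le_mul_left h1 hN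
  nlinarith

theorem IsQuasiEquidistributing.rho_mul_len_le (h : π.IsQuasiEquidistributing v κ) (hi : i < N) :
    π.rho v i * π.len i ≤ 2 * κ / N := by
  have hs : 0 < π.sigma v := zero_lt_one.trans_le (one_le_sigma v)
  have hN : (0 : ℝ) < N := Nat.cast_pos.2 π.pos
  have h1 := (div_le_iff₀ hs).1 (h i hi)
  rw [le_div_iff₀ hN]
  nlinarith [sigma_le_two (π := π) v, h.one_le]

theorem IsQuasiEquidistributing.len_le (h : π.IsQuasiEquidistributing v κ) (hi : i < N) : π.len i ≤ 2 * κ / N :=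
  (le_mul_of_one_le_left (π.len_pos hi).le (one_le_rho v i)).trans (h.rho_mul_len_le hi)

theorem IsQuasiEquidistributing.len_mul_rpow_le (h : π.IsQuasiEquidistributing v κ) (hi : i < N) :
    π.len i * π.avg v i ^ (2 / 3 : ℝ) ≤ 2 * κ / N * π.avgSum v := by
  have hl := π.len_pos hi
  -- If the sum is zero, the adaptation function carries no information, but then every single term
  -- vanishes.
  rcases (avgSum_nonneg (π := π) v).eq_or_lt with h0 | h0
  · rw [← h0, mul_zero]
    have h1 := Finset.single_le_sum (f := fun i => π.len i * π.avg v i ^ (2 / 3 : ℝ))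
      (fun j hj => avgSum_term_nonneg v (Finset.mem_range.1 hj)) (Finset.mem_range.2 hi)
    exact h1.trans h0.symm.le
  · have h1 := (mul_le_mul_of_nonneg_right (inv_mul_le_rho (π := π) v i) hl.le).trans
      (h.rho_mul_len_le hi)
    rw [mul_assoc, inv_mul_le_iff₀ h0] at h1
    linarith

/-- Substituting $t=\langle v\rangle_i^{1/3}$ makes the fractional powers below polynomial. -/
theorem exists_cube_root_avg (v : ℝ → ℝ) (i : ℕ) :
    ∃ t : ℝ, 0 ≤ t ∧ π.avg v i = t ^ 3 ∧ π.avg v i ^ (2 / 3 : ℝ) = t ^ 2 := by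
  have h0 := avg_nonneg (π := π) v i
  refine ⟨π.avg v i ^ (1 / 3 : ℝ), by positivity, ?_, ?_⟩ <;>
  · rw [← Real.rpow_natCast, ← Real.rpow_mul h0]
    norm_num

theorem IsQuasiEquidistributing.sum_len_sq_mul_avg_le (h : π.IsQuasiEquidistributing v κ) :
    ∑ i ∈ Finset.range N, π.len i * (π.len i * π.avg v i)
      ≤ 2 * κ / N * √(π.alpha v) := by
  have hκ := h.one_le
  have hN : (0 : ℝ) < N := Nat.cast_pos.2 π.pos
  have hS := avgSum_nonneg (π := π) v
  have e : √(π.alpha v) = √(π.avgSum v) * π.avgSum v := by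
    rw [alpha_eq, pow_succ, Real.sqrt_mul (sq_nonneg _), Real.sqrt_sq hS, mul_comm]
  rw [e, ← mul_assoc]
  conv_rhs => rw [avgSum, Finset.mul_sum]
  refine Finset.sum_le_sum fun i hi => ?_
  rw [Finset.mem_range] at hi
  have hl := π.len_pos hi
  have h1 := h.len_mul_rpow_le hi
  obtain ⟨t, ht, e1, e2⟩ := exists_cube_root_avg (π := π) v i
  rw [e2] at h1 ⊢
  rw [e1]
  -- The geometric mean of the two mesh bounds, on $h_i$ and on $h_it^2$.
  have h2 : π.len i * t ≤ 2 * κ / N * √(π.avgSum v) := by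
    refine abs_le_of_sq_le_sq' ?_ (by positivity) |>.2
    rw [mul_pow, mul_pow, Real.sq_sqrt hS]
    calc π.len i ^ 2 * t ^ 2 = π.len i * (π.len i * t ^ 2) := by ring
      _ ≤ 2 * κ / N * (2 * κ / N * π.avgSum v) := by
        gcongr
        exact h.len_le hi
      _ = _ := by ring
  calc π.len i * (π.len i * t ^ 3) = (π.len i * t) * (π.len i * t ^ 2) := by ring
    _ ≤ 2 * κ / N * √(π.avgSum v) * (π.len i * t ^ 2) := by gcongr

/-- Each term is the cube of $h_i\langle v\rangle_i^{2/3}$. Two factors are bounded by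
equidistribution, and the third is summed. -/
theorem IsQuasiEquidistributing.sum_len_cube_mul_avg_sq_le (h : π.IsQuasiEquidistributing v κ) :
    ∑ i ∈ Finset.range N, π.len i * (π.len i * π.avg v i) ^ 2
      ≤ (2 * κ / N) ^ 2 * π.alpha v := by
  have hS := avgSum_nonneg (π := π) v
  have e : (2 * κ / N) ^ 2 * π.alpha v = (2 * κ / N * π.avgSum v) ^ 2 * π.avgSum v := by
    rw [alpha_eq]
    ring
  rw [e]
  conv_rhs => rw [avgSum.eq_def π v, Finset.mul_sum, ← avgSum.eq_def π v]
  refine Finset.sum_le_sum fun i hi => ?_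
  rw [Finset.mem_range] at hi
  have hl := π.len_pos hi
  have h1 := h.len_mul_rpow_le hi
  obtain ⟨t, ht, e1, e2⟩ := exists_cube_root_avg (π := π) v i
  rw [e2] at h1 ⊢
  rw [e1]
  calc π.len i * (π.len i * t ^ 3) ^ 2 = (π.len i * t ^ 2) ^ 2 * (π.len i * t ^ 2) := by ring
    _ ≤ (2 * κ / N * π.avgSum v) ^ 2 * (π.len i * t ^ 2) := by gcongr

theorem IsQuasiEquidistributing.sum_len_mul_rpow_le (h : π.IsQuasiEquidistributing v κ) :
    ∑ i ∈ Finset.range N, π.len i * (π.len i * π.avg v i) ^ (2 / 3 : ℝ)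
      ≤ (2 * κ / N) ^ (2 / 3 : ℝ) * π.avgSum v := by
  rw [avgSum, Finset.mul_sum]
  refine Finset.sum_le_sum fun i hi => ?_
  rw [Finset.mem_range] at hi
  have hl := π.len_pos hi
  have h1 := h.len_le hi
  have h0 := avg_nonneg (π := π) v i
  rw [Real.mul_rpow hl.le h0, mul_left_comm]
  gcongr

end QuasiEquidistributing

/-- Bounds for a function that is dominated cellwise by the mean of another one. -/
theorem IsQuasiEquidistributing.bounds_of_dominated {v R : ℝ → ℝ} {κ : ℝ}
    (h : π.IsQuasiEquidistributing v κ) (hv : MemLp v 2 muOmega) (hR : MemLp R 2 muOmega)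
    (hRv : ∀ i < N, ∀ᵐ x ∂muOmega, x ∈ π.cell i → |R x| ≤ ∫ t in π.cell i, |v t|) :
    ∫ x in Omega, |R x| ≤ 2 * κ / N * √(π.alpha v) ∧
    ∫ x in Omega, R x ^ 2 ≤ (2 * κ / N) ^ 2 * π.alpha v ∧
    π.avgSum R ≤ (2 * κ / N) ^ (2 / 3 : ℝ) * π.avgSum v := by
  have hb : ∀ i < N, ∀ᵐ x ∂muOmega, x ∈ π.cell i → |R x| ≤ π.len i * π.avg v i := fun i hi =>
    (hRv i hi).mono fun x hx hxc => (hx hxc).trans (integral_cell_abs_le hi hv)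
  have h0 : ∀ i < N, 0 ≤ π.len i * π.avg v i := fun i hi =>
    mul_nonneg (π.len_pos hi).le (avg_nonneg v i)
  have hR' : Integrable (fun x => |R x|) muOmega := (MemLp.integrable_of_two hR).abs
  refine ⟨?_, ?_, (avgSum_le_of_bound h0 hb).trans h.sum_len_mul_rpow_le⟩
  · refine le_trans ?_ h.sum_len_sq_mul_avg_le
    rw [← π.sum_integral_cell hR']
    refine Finset.sum_le_sum fun i hi => ?_
    rw [Finset.mem_range] at hi
    have := π.len_pos hi
    refine (integral_cell_abs_le hi hR).trans ?_
    gcongr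
    exact avg_le_of_bound hi (h0 i hi) (hb i hi)
  · refine le_trans ?_ h.sum_len_cube_mul_avg_sq_le
    rw [← π.sum_integral_cell hR.integrable_sq]
    refine Finset.sum_le_sum fun i hi => ?_
    rw [Finset.mem_range] at hi
    have := π.len_pos hi
    have := avg_nonneg (π := π) R i
    rw [← len_mul_avg_sq hi]
    gcongr
    exact avg_le_of_bound hi (h0 i hi) (hb i hi)

end Mesh

/-! ### Approximation of $\int|r|^{2/3}$ by cell averages. -/

namespace Mesh

variable {N : ℕ} {π : Mesh N}

theorem avgSum_congr {v w : ℝ → ℝ} (h : v =ᵐ[muOmega] w) : π.avgSum v = π.avgSum w := by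
  refine Finset.sum_congr rfl fun i hi => ?_
  rw [Finset.mem_range] at hi
  rw [avg, avg, integral_congr_ae ((ae_cell h hi).mono fun x hx => show _ = |w x| ^ 2 by rw [hx])]

theorem avgSum_const_le {k : ℝ} (hk : 0 ≤ k) :
    π.avgSum (fun _ => k) ≤ k ^ (2 / 3 : ℝ) := by
  refine (avgSum_le_of_bound (V := fun _ => k) (fun _ _ => hk) fun i hi =>
    Eventually.of_forall fun x _ => (abs_of_nonneg hk).le).trans ?_
  rw [← Finset.sum_mul, π.sum_len, one_mul]

/-- At every point $x$ of a cell the average is at most $|g(x)|+V_i$; raise this to the power $2/3$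
and integrate over $x$. -/
theorem avgSum_le_of_oscillation {g : ℝ → ℝ} {V : ℕ → ℝ} (hg : MemLp g 2 muOmega)
    (hV : ∀ i < N, 0 ≤ V i)
    (hosc : ∀ i < N, ∀ x ∈ π.cell i, ∀ y ∈ π.cell i, |g x - g y| ≤ V i) :
    π.avgSum g ≤ (∫ x in Omega, |g x| ^ (2 / 3 : ℝ))
      + ∑ i ∈ Finset.range N, π.len i * V i ^ (2 / 3 : ℝ) := by
  have hint := integrable_abs_rpow hg
  rw [← π.sum_integral_cell hint, ← Finset.sum_add_distrib]
  refine Finset.sum_le_sum fun i hi => ?_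
  rw [Finset.mem_range] at hi
  have hfin : volume (π.cell i) < ⊤ := by simp [cell]
  have hconst : ∀ k : ℝ, IntegrableOn (fun _ : ℝ => k) (π.cell i) := fun k =>
    integrableOn_const hfin.ne
  have e : ∀ k : ℝ, ∫ _ in π.cell i, k = π.len i * k := fun k => by
    rw [setIntegral_const, volume_real_cell hi, smul_eq_mul]
  rw [← e, ← e, ← integral_add (integrableOn_cell hint hi) (hconst _)]
  refine setIntegral_mono_on (hconst _) ((integrableOn_cell hint hi).add (hconst _))
    (π.measurableSet_cell i) fun x hx => ?_
  have h1 : π.avg g i ≤ |g x| + V i := by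
    refine avg_le_of_bound hi (add_nonneg (abs_nonneg _) (hV i hi))
      (Eventually.of_forall fun y hy => ?_)
    have h2 := abs_sub_abs_le_abs_sub (g y) (g x)
    have h3 := hosc i hi y hy x hx
    linarith
  refine (Real.rpow_le_rpow (avg_nonneg g i) h1 (by norm_num)).trans ?_
  exact Real.rpow_add_le_add_rpow (abs_nonneg _) (hV i hi) (by norm_num) (by norm_num)

/-- Jensen for the concave $t^{2/3}$ pulls the power outside the sum; only then is
$h_i\le\varepsilon$ used. -/
theorem sum_len_mul_rpow_le {V : ℕ → ℝ} {ε : ℝ} (hV : ∀ i < N, 0 ≤ V i)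
    (hε : ∀ i < N, π.len i ≤ ε) :
    ∑ i ∈ Finset.range N, π.len i * V i ^ (2 / 3 : ℝ)
      ≤ (ε * ∑ i ∈ Finset.range N, V i) ^ (2 / 3 : ℝ) := by
  have hcc := Real.concaveOn_rpow (p := 2 / 3) (by norm_num) (by norm_num)
  have h := hcc.le_map_sum (t := Finset.range N) (w := fun i => π.len i) (p := V)
    (fun i hi => (π.len_pos (Finset.mem_range.1 hi)).le) π.sum_len
    (fun i hi => mem_Ici.2 (hV i (Finset.mem_range.1 hi)))
  simp only [smul_eq_mul] at h
  refine h.trans (Real.rpow_le_rpow (Finset.sum_nonneg fun i hi => ?_) ?_ (by norm_num))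
  · exact mul_nonneg (π.len_pos (Finset.mem_range.1 hi)).le (hV i (Finset.mem_range.1 hi))
  · rw [Finset.mul_sum]
    exact Finset.sum_le_sum fun i hi =>
      mul_le_mul_of_nonneg_right (hε i (Finset.mem_range.1 hi)) (hV i (Finset.mem_range.1 hi))

/-- The cellwise averages of a function with integrable derivative. -/
theorem avgSum_le_of_memW1 {r : ℝ → ℝ} {ε : ℝ} (hr : MemLp r 2 muOmega) (hr1 : MemW1 1 r)
    (hε : ∀ i < N, π.len i ≤ ε) :
    π.avgSum r ≤ (∫ x in Omega, |r x| ^ (2 / 3 : ℝ))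
      + (ε * ∫ x in Omega, |weakDeriv r x|) ^ (2 / 3 : ℝ) := by
  have hd : Integrable (weakDeriv r) muOmega := memLp_one_iff_integrable.1 hr1.memLp_weakDeriv
  obtain ⟨k, hk⟩ := hr1.hasWeakDeriv.exists_ae_eq_prim hd
  set g : ℝ → ℝ := fun x => k + prim (weakDeriv r) x with hg
  have hrg : r =ᵐ[muOmega] g := hk
  have hg2 : MemLp g 2 muOmega := (memLp_congr_ae hrg).1 hr
  have hV : ∀ i < N, 0 ≤ ∫ x in π.cell i, |weakDeriv r x| := fun i _ =>
    integral_nonneg fun x => abs_nonneg _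
  have h1 := avgSum_le_of_oscillation (π := π) hg2 hV fun i hi x hx y hy => ?_
  · rw [avgSum_congr hrg]
    have h2 := sum_len_mul_rpow_le hV hε
    have hda : Integrable (fun x => |weakDeriv r x|) muOmega := hd.abs
    rw [π.sum_integral_cell hda] at h2
    rw [integral_congr_ae (hrg.mono fun x hx => show _ = |g x| ^ (2 / 3 : ℝ) by rw [hx])]
    linarith
  · have hx1 := Omega_subset_Icc (π.cell_subset hi hx)
    have hy1 := Omega_subset_Icc (π.cell_subset hi hy)
    have hsub : uIoc y x ⊆ π.cell i := fun t ht =>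
      (ordConnected_Ioo.uIcc_subset hy hx) (uIoc_subset_uIcc ht)
    have e : g x - g y = ∫ t in y..x, weakDeriv r t := by
      rw [← prim_sub_prim hd hy1 hx1, hg]
      ring
    rw [e]
    have h1 : |∫ t in y..x, weakDeriv r t| ≤ ∫ t in uIoc y x, |weakDeriv r t| :=
      intervalIntegral.norm_integral_le_integral_norm_uIoc (f := weakDeriv r) (μ := volume)
    exact h1.trans (setIntegral_mono_set (integrableOn_cell hd.abs hi)
      (Eventually.of_forall fun t => abs_nonneg _) hsub.eventuallyLE)

end Mesh

/-- On fine meshes, the sum of the cellwise averages is close to the integral. -/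
theorem exists_avgSum_le {r : ℝ → ℝ} (hr : MemLp r 2 muOmega) {η : ℝ} (hη : 0 < η) :
    ∃ δ > 0, ∀ (N : ℕ) (π : Mesh N), (∀ i < N, π.len i ≤ δ) →
      π.avgSum r ≤ (∫ x in Omega, |r x| ^ (2 / 3 : ℝ)) + η := by
  have hr' : MemLp r (ENNReal.ofReal 2) muOmega := by simpa using hr
  -- The tolerance is cubed because `avgSum_le_integral_sq` takes a cube root. The three thirds of
  -- `η` pay for the average sum of `r - g`, for its integral, and for the oscillation of `g`.
  obtain ⟨g, hgc, hgr, hgcont, hg2⟩ := hr'.exists_hasCompactSupport_integral_rpow_sub_le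
    (by norm_num) (ε := (η / 3) ^ 3) (by positivity)
  replace hg2 : MemLp g 2 muOmega := by simpa using hg2
  set d : ℝ → ℝ := fun x => r x - g x with hd
  have hd2 : MemLp d 2 muOmega := hr.sub hg2
  have hdη : (∫ x in Omega, d x ^ 2) ^ (1 / 3 : ℝ) ≤ η / 3 := by
    have h1 : ∫ x in Omega, d x ^ 2 ≤ (η / 3) ^ 3 := by
      refine le_trans (le_of_eq (integral_congr_ae (Eventually.of_forall fun x => ?_))) hgr
      simp only [hd]
      rw [Real.rpow_two, Real.norm_eq_abs, sq_abs]
    refine (Real.rpow_le_rpow (integral_nonneg fun x => sq_nonneg _) h1 (by norm_num)).trans ?_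
    rw [← Real.rpow_natCast, ← Real.rpow_mul (by positivity)]
    norm_num
  set V : ℝ := (η / 3) ^ (3 / 2 : ℝ) with hVdef
  have hV : 0 < V := by positivity
  have hVη : V ^ (2 / 3 : ℝ) = η / 3 := by
    rw [hVdef, ← Real.rpow_mul (by positivity)]
    norm_num
  obtain ⟨δ, hδ, hδV⟩ := Metric.uniformContinuous_iff.1
    (hgc.uniformContinuous_of_continuous hgcont) V hV
  refine ⟨δ, hδ, fun N π hπ => ?_⟩
  have h1 := Mesh.avgSum_le_of_oscillation (π := π) hg2 (V := fun _ => V) (fun _ _ => hV.le)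
    fun i hi x hx y hy => by
      refine (hδV ?_).le
      rw [Real.dist_eq, abs_lt]
      have := hπ i hi
      rw [Mesh.len] at this
      constructor <;> linarith [hx.1, hx.2, hy.1, hy.2]
  rw [← Finset.sum_mul, π.sum_len, one_mul, hVη] at h1
  have h2 := Mesh.avgSum_le_add (π := π) hr hg2 hd2 (Eventually.of_forall fun x => by
    have : r x = g x + d x := by simp [hd]
    rw [this]
    exact abs_add_le _ _)
  have h3 := (Mesh.avgSum_le_integral_sq (π := π) hd2).trans hdη
  have h4 := (Mesh.integral_rpow_le_avgSum (π := π) hd2).trans h3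
  have h5 : ∫ x in Omega, |g x| ^ (2 / 3 : ℝ)
      ≤ (∫ x in Omega, |r x| ^ (2 / 3 : ℝ)) + ∫ x in Omega, |d x| ^ (2 / 3 : ℝ) := by
    have i1 := Mesh.integrable_abs_rpow hr
    have i2 := Mesh.integrable_abs_rpow hd2
    rw [← integral_add i1 i2]
    refine integral_mono (Mesh.integrable_abs_rpow hg2) (i1.add i2) fun x => ?_
    have h6 : |g x| ≤ |r x| + |d x| := by
      have : g x = r x - d x := by simp [hd]
      rw [this]
      exact abs_sub _ _
    exact (Real.rpow_le_rpow (abs_nonneg _) h6 (by norm_num)).trans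
      (Real.rpow_add_le_add_rpow (abs_nonneg _) (abs_nonneg _) (by norm_num) (by norm_num))
  linarith

/-! ### Comparison of the two residuals. -/

/-- The cellwise averages of `r - rh` are small compared with those of `rh`, up to order
`κ / N`, once the estimates for a weak solution and a finite element solution are available. -/
theorem Mesh.IsQuasiEquidistributing.avgSum_sub_le {N : ℕ} {π : Mesh N} {r rh R d : ℝ → ℝ}
    {κ C : ℝ} (hC : 1 ≤ C) (h : π.IsQuasiEquidistributing rh κ)
    (hr : MemLp r 2 muOmega) (hrh : MemLp rh 2 muOmega) (hR : MemLp R 2 muOmega)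
    (hd : MemLp d 2 muOmega)
    (hRb : ∀ i < N, ∀ᵐ x ∂muOmega, x ∈ π.cell i → |R x| ≤ ∫ t in π.cell i, |rh t|)
    (hdb : ∫ x in Omega, d x ^ 2 ≤ (C * ∫ x in Omega, |R x|) ^ 2)
    (hb : ∀ᵐ x ∂muOmega, |r x - rh x| ≤ C * (|R x| + ∫ x in Omega, |R x|) + |d x|) :
    π.avgSum (fun x => r x - rh x) ≤ (κ * (12 * C) / N) ^ (2 / 3 : ℝ) * π.avgSum rh := by
  obtain ⟨h1, -, h3⟩ := h.bounds_of_dominated hrh hR hRb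
  have hN : (0 : ℝ) < N := Nat.cast_pos.2 π.pos
  have hκ := h.one_le
  have hC0 : 0 ≤ C := by linarith
  set J := ∫ x in Omega, |R x| with hJ
  have hJ0 : 0 ≤ J := integral_nonneg fun x => abs_nonneg _
  set S := π.avgSum rh with hS
  have hS0 : 0 ≤ S := Mesh.avgSum_nonneg rh
  set ε := 2 * κ / N with hε
  have hε0 : 0 ≤ ε := by positivity
  -- Since $\sqrt{\alpha_h}=S^{3/2}$, the bound $J\le\varepsilon\sqrt{\alpha_h}$ becomes linear in
  -- $S$ after taking the power $2/3$.
  have hJS : (C * J) ^ (2 / 3 : ℝ) ≤ (C * ε) ^ (2 / 3 : ℝ) * S := by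
    rw [Mesh.sqrt_alpha, ← hS] at h1
    have : C * J ≤ C * ε * S ^ (3 / 2 : ℝ) := by
      rw [mul_assoc]
      gcongr
    refine (Real.rpow_le_rpow (by positivity) this (by norm_num)).trans (le_of_eq ?_)
    rw [Real.mul_rpow (by positivity) (by positivity), ← Real.rpow_mul hS0]
    norm_num
  have k1 : π.avgSum (fun x => C * R x) ≤ (C * ε) ^ (2 / 3 : ℝ) * S := by
    rw [Mesh.avgSum_const_mul hC0, Real.mul_rpow hC0 hε0, mul_assoc]
    gcongr
  have k2 : π.avgSum d ≤ (C * ε) ^ (2 / 3 : ℝ) * S := by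
    refine ((Mesh.avgSum_le_integral_sq hd).trans (Real.rpow_le_rpow
      (integral_nonneg fun x => sq_nonneg _) hdb (by norm_num))).trans (le_trans (le_of_eq ?_) hJS)
    rw [← Real.rpow_natCast, ← Real.rpow_mul (by positivity)]
    norm_num
  have k3 : π.avgSum (fun _ => C * J) ≤ (C * ε) ^ (2 / 3 : ℝ) * S :=
    (Mesh.avgSum_const_le (by positivity)).trans hJS
  have hda : MemLp (fun x => |d x|) 2 muOmega := hd.norm
  have hCJ : MemLp (fun _ : ℝ => C * J) 2 muOmega := memLp_const _
  have hs : MemLp (fun x => C * J + |d x|) 2 muOmega := hCJ.add hda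
  have m1 := Mesh.avgSum_le_add (π := π) (v := fun x => r x - rh x) (hr.sub hrh) (hR.const_mul C)
    hs (hb.mono fun x hx => by
      rw [abs_mul, abs_of_nonneg hC0, abs_of_nonneg (by positivity : 0 ≤ C * J + |d x|)]
      linarith)
  have m2 := Mesh.avgSum_le_add (π := π) hs hCJ hd (Eventually.of_forall fun x => by
    rw [abs_of_nonneg (by positivity : 0 ≤ C * J + |d x|),
      abs_of_nonneg (by positivity : 0 ≤ C * J)])
  have e : κ * (12 * C) / N = 6 * (C * ε) := by
    rw [hε]
    ring
  -- Three contributions, from `C * R`, `C * J` and `d`, each cost `(C * ε) ^ (2 / 3)`. The factor 3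
  -- goes inside the power as 6, and with `ε = 2 * κ / N` this is the 12 in the constant.
  have h36 : (3 : ℝ) ≤ 6 ^ (2 / 3 : ℝ) := by
    refine le_of_pow_le_pow_left₀ (n := 3) (by norm_num) (by positivity) ?_
    rw [← Real.rpow_natCast (6 ^ (2 / 3 : ℝ)), ← Real.rpow_mul (by norm_num)]
    norm_num
  rw [e, Real.mul_rpow (by norm_num) (by positivity), mul_assoc]
  have hp : 0 ≤ (C * ε) ^ (2 / 3 : ℝ) * S := by positivity
  nlinarith

theorem toReal_two_thirds : (2 / 3 : ℝ≥0∞).toReal = 2 / 3 := by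
  simp [ENNReal.toReal_div]

theorem normLp_two_thirds {v : ℝ → ℝ} (hv : MemLp v 2 muOmega) :
    normLp (2 / 3) v = (∫ x in Omega, |v x| ^ (2 / 3 : ℝ)) ^ (3 / 2 : ℝ) := by
  have hle : (2 / 3 : ℝ≥0∞) ≤ 2 := ENNReal.div_le_of_le_mul (by norm_num)
  rw [normLp_eq_integral (by norm_num) (ENNReal.div_ne_top (by norm_num) (by norm_num))
    (hv.mono_exponent hle), toReal_two_thirds]
  norm_num

theorem normLp_two {v : ℝ → ℝ} (hv : MemLp v 2 muOmega) :
    normLp 2 v = √(∫ x in Omega, v x ^ 2) := by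
  rw [normLp_eq_integral (by norm_num) (by norm_num) hv, Real.sqrt_eq_rpow]
  simp

theorem normLp_one {v : ℝ → ℝ} (hv : MemLp v 1 muOmega) :
    normLp 1 v = ∫ x in Omega, |v x| := by
  rw [normLp_eq_integral (by norm_num) (by norm_num) hv]
  simp

/-- The two-sided comparison of cellwise sums of functions that differ by a small fraction. -/
theorem Mesh.avgSum_comparison {N : ℕ} {π : Mesh N} {r rh : ℝ → ℝ} {δ : ℝ}
    (hr : MemLp r 2 muOmega) (hrh : MemLp rh 2 muOmega)
    (h : π.avgSum (fun x => r x - rh x) ≤ δ * π.avgSum rh) :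
    π.avgSum r ≤ (1 + δ) * π.avgSum rh ∧ (1 - δ) * π.avgSum rh ≤ π.avgSum r := by
  have hs : MemLp (fun x => r x - rh x) 2 muOmega := hr.sub hrh
  have h1 := Mesh.avgSum_le_add (π := π) hr hrh hs (Eventually.of_forall fun x => by
    have := abs_add_le (rh x) (r x - rh x)
    rwa [add_sub_cancel] at this)
  have h2 := Mesh.avgSum_le_add (π := π) hrh hr hs (Eventually.of_forall fun x => by
    have := abs_sub (r x) (r x - rh x)
    rwa [sub_sub_cancel] at this)
  constructor <;> linarith

theorem rpow_neg_mul_rpow_le_iff {p x y : ℝ} (hp : 0 < p) (hx : 0 ≤ x) (hy : 0 ≤ y) :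
    p ^ (-(3 / 2) : ℝ) * x ^ (3 / 2 : ℝ) ≤ y ^ (3 / 2 : ℝ) ↔ x ≤ p * y := by
  rw [Real.rpow_neg hp.le, inv_mul_le_iff₀ (by positivity), ← Real.mul_rpow hp.le hy,
    Real.rpow_le_rpow_iff hx (by positivity) (by norm_num)]

theorem le_rpow_neg_mul_rpow_iff {p x y : ℝ} (hp : 0 < p) (hx : 0 ≤ x) (hy : 0 ≤ y) :
    x ^ (3 / 2 : ℝ) ≤ p ^ (-(3 / 2) : ℝ) * y ^ (3 / 2 : ℝ) ↔ p * x ≤ y := by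
  rw [Real.rpow_neg hp.le, le_inv_mul_iff₀ (by positivity), ← Real.mul_rpow hp.le hx,
    Real.rpow_le_rpow_iff (by positivity) hy (by norm_num)]

end AdaptiveFEM

/-! ### The theorem. -/

open AdaptiveFEM
theorem theorem2p2 (a₀ : ℝ) (a b c : ℝ → ℝ) (hcoef : Coefficients a₀ a b c) :
    ∃ C c₁ : ℝ, 0 < C ∧ 0 < c₁ ∧
      ∀ f u : ℝ → ℝ, MemLp f 2 muOmega → IsWeakSolution a b c f u → ∀ κ : ℝ, 0 < κ →
        -- the error bound
        (∀ (N : ℕ) (π : Mesh N) (uh : ℝ → ℝ), π.IsFESolution a b c f uh →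
          π.IsQuasiEquidistributing (pdeResidual a b c f uh) κ →
          normLp 2 (weakDeriv (u - uh)) ≤
            C * √(π.alpha (pdeResidual a b c f uh) * κ ^ 3) / N) ∧
        -- the limit of the intensity parameter, along any such meshes with `N → ∞`
        (∀ (N : ℕ → ℕ) (π : ∀ k, Mesh (N k)) (uh : ℕ → ℝ → ℝ),
          (∀ k, (π k).IsFESolution a b c f (uh k)) →
          (∀ k, (π k).IsQuasiEquidistributing (pdeResidual a b c f (uh k)) κ) →
          Tendsto N atTop atTop →
          Tendsto (fun k => √((π k).alpha (pdeResidual a b c f (uh k)))) atTop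
            (𝓝 (normLp (2 / 3) (pdeResidual a b c f u)))) ∧
        -- the two-sided bound when `r' ∈ L¹`
        (MemW1 1 (pdeResidual a b c f u) →
          ∀ (N : ℕ) (π : Mesh N) (uh : ℝ → ℝ), π.IsFESolution a b c f uh →
          π.IsQuasiEquidistributing (pdeResidual a b c f uh) κ → κ * c₁ < N →
          (1 + (κ * c₁ / N) ^ (2 / 3 : ℝ)) ^ (-(3 / 2) : ℝ)
              * normLp (2 / 3) (pdeResidual a b c f u)
            ≤ √(π.alpha (pdeResidual a b c f uh)) ∧
          √(π.alpha (pdeResidual a b c f uh))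
            ≤ (1 - (κ * c₁ / N) ^ (2 / 3 : ℝ)) ^ (-(3 / 2) : ℝ)
              * (normLp (2 / 3) (pdeResidual a b c f u) ^ (2 / 3 : ℝ)
                + (κ * c₁ * normLp 1 (weakDeriv (pdeResidual a b c f u)) / N) ^ (2 / 3 : ℝ))
                  ^ (3 / 2 : ℝ)) := by
  obtain ⟨C, hC1, hC⟩ := hcoef.exists_error_estimate
  have hC0 : 0 < C := by linarith
  refine ⟨2 * C, 12 * C, by positivity, by positivity, fun f u hf hu κ hκ => ?_⟩
  obtain ⟨hr, hest⟩ := hC f u hf hu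
  set r := pdeResidual a b c f u with hrdef
  set I := ∫ x in Omega, |r x| ^ (2 / 3 : ℝ) with hI
  have hI0 : 0 ≤ I := integral_nonneg fun x => by positivity
  have hcomp : ∀ (N : ℕ) (π : Mesh N) (uh : ℝ → ℝ), π.IsFESolution a b c f uh →
      π.IsQuasiEquidistributing (pdeResidual a b c f uh) κ →
      π.avgSum r ≤ (1 + (κ * (12 * C) / N) ^ (2 / 3 : ℝ)) * π.avgSum (pdeResidual a b c f uh) ∧
      (1 - (κ * (12 * C) / N) ^ (2 / 3 : ℝ)) * π.avgSum (pdeResidual a b c f uh)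
        ≤ π.avgSum r := by
    intro N π uh hFE hQ
    obtain ⟨hrh, -, R, d, hR, hd, hRb, -, hdb, hb⟩ := hest N π uh hFE
    exact Mesh.avgSum_comparison hr hrh (hQ.avgSum_sub_le hC1 hr hrh hR hd hRb hdb hb)
  refine ⟨fun N π uh hFE hQ => ?_, fun N π uh hFE hQ hN => ?_,
    fun hW N π uh hFE hQ hκN => ?_⟩
  · obtain ⟨hrh, he, R, d, hR, -, hRb, heR, -, -⟩ := hest N π uh hFE
    obtain ⟨-, h2, -⟩ := hQ.bounds_of_dominated hrh hR hRb
    have hκ1 := hQ.one_le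
    have hα := Mesh.alpha_nonneg (π := π) (pdeResidual a b c f uh)
    have hN0 : (0 : ℝ) < N := Nat.cast_pos.2 π.pos
    rw [normLp_two he]
    refine Real.sqrt_le_iff.2 ⟨by positivity, heR.trans ?_⟩
    rw [div_pow, mul_pow, Real.sq_sqrt (by positivity)]
    calc C ^ 2 * ∫ x in Omega, R x ^ 2
        ≤ C ^ 2 * ((2 * κ / N) ^ 2 * π.alpha (pdeResidual a b c f uh)) := by gcongr
      _ = (2 * C) ^ 2 * (π.alpha (pdeResidual a b c f uh) * κ ^ 2) / N ^ 2 := by ring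
      -- The estimate holds with $\kappa^2$; the cube is a weakening, by $\kappa\ge1$.
      _ ≤ (2 * C) ^ 2 * (π.alpha (pdeResidual a b c f uh) * κ ^ 3) / N ^ 2 := by
        gcongr
        norm_num
  · have hNr : Tendsto (fun k => (N k : ℝ)) atTop atTop := tendsto_natCast_atTop_atTop.comp hN
    have hδ : Tendsto (fun k => (κ * (12 * C) / N k) ^ (2 / 3 : ℝ)) atTop (𝓝 0) := by
      have := (hNr.const_div_atTop (κ * (12 * C))).rpow_const (p := 2 / 3)
        (Or.inr (by norm_num))
      rwa [Real.zero_rpow (by norm_num)] at this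
    have hB : Tendsto (fun k => (π k).avgSum r) atTop (𝓝 I) := by
      refine Metric.tendsto_atTop.2 fun η hη => ?_
      obtain ⟨δ, hδ0, hδ⟩ := exists_avgSum_le hr (half_pos hη)
      obtain ⟨k₀, hk₀⟩ := eventually_atTop.1
        ((hNr.const_div_atTop (2 * κ)).eventually (gt_mem_nhds hδ0))
      refine ⟨k₀, fun k hk => ?_⟩
      have h1 := hδ (N k) (π k) fun i hi => ((hQ k).len_le hi).trans (hk₀ k hk).le
      have h2 := Mesh.integral_rpow_le_avgSum (π := π k) hr
      rw [Real.dist_eq, abs_lt]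
      constructor <;> linarith
    -- Squeezed between $S(r)/(1+\delta_k)$ and $S(r)/(1-\delta_k)$; the upper bound makes sense
    -- only once $\delta_k<1$.
    have hA : Tendsto (fun k => (π k).avgSum (pdeResidual a b c f (uh k))) atTop (𝓝 I) := by
      have t1 := hB.div (hδ.const_add 1) (by norm_num)
      have t2 := hB.div (hδ.const_sub 1) (by norm_num)
      rw [add_zero, div_one] at t1
      rw [sub_zero, div_one] at t2
      refine tendsto_of_tendsto_of_tendsto_of_le_of_le' t1 t2 (Eventually.of_forall fun k => ?_) ?_
      · have : 0 ≤ (κ * (12 * C) / N k) ^ (2 / 3 : ℝ) := by positivity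
        exact (div_le_iff₀' (by linarith)).2 (hcomp _ _ _ (hFE k) (hQ k)).1
      · filter_upwards [hδ.eventually (gt_mem_nhds one_pos)] with k hk
        exact (le_div_iff₀' (by linarith)).2 (hcomp _ _ _ (hFE k) (hQ k)).2
    rw [normLp_two_thirds hr]
    simp only [Mesh.sqrt_alpha]
    exact hA.rpow_const (Or.inr (by norm_num))
  · have hN0 : (0 : ℝ) < N := Nat.cast_pos.2 π.pos
    obtain ⟨h1, h2⟩ := hcomp N π uh hFE hQ
    have hδ1 : (κ * (12 * C) / N) ^ (2 / 3 : ℝ) < 1 :=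
      Real.rpow_lt_one (by positivity) ((div_lt_one hN0).2 hκN) (by norm_num)
    have hδ0 : 0 ≤ (κ * (12 * C) / N) ^ (2 / 3 : ℝ) := by positivity
    have hS := Mesh.avgSum_nonneg (π := π) (pdeResidual a b c f uh)
    rw [Mesh.sqrt_alpha, normLp_two_thirds hr, normLp_one hW.memLp_weakDeriv]
    set L := ∫ x in Omega, |weakDeriv r x| with hL
    have hL0 : 0 ≤ L := integral_nonneg fun x => abs_nonneg _
    refine ⟨(rpow_neg_mul_rpow_le_iff (by linarith) hI0 hS).2
      ((Mesh.integral_rpow_le_avgSum hr).trans h1),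
      (le_rpow_neg_mul_rpow_iff (by linarith) hS (by positivity)).2 (h2.trans ?_)⟩
    -- The cell lengths are at most `2 * κ / N`, which `κ * (12 * C) / N` dominates because `1 ≤ C`;
    -- one constant thus serves both purposes.
    refine (Mesh.avgSum_le_of_memW1 hr hW fun i hi => hQ.len_le hi).trans ?_
    rw [← Real.rpow_mul hI0]
    norm_num only [Real.rpow_one]
    gcongr
    rw [div_mul_eq_mul_div]
    exact div_le_div_of_nonneg_right (mul_le_mul_of_nonneg_right (by nlinarith) hL0) hN0.le
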